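/- Let $A,C\in\mathbb R^{n\times n}$ and $B\in\mathbb R^{n\times m}$ with $C$ nonsingular, and consider $$x(t+1)=Ax(t)+Bu(t)+w(t),\qquad y(t)=Cx(t)+v(t),\qquad t=0,1,2,\dots$$ The initial state $x(0)=x_0$ is Gaussian. The $w(t)$ are i.i.d. with $\Pr(w(t)=w_i)=p_i$ for given vectors $w_1,\dots,w_M$. The $v(t)$ are i.i.d. with mean $0$, $\|v(t)\|\le v_b$ almost surely, and $Q_v=E[v(t)v(t)']$. The variables $x_0,w(0),w(1),\dots,v(0),v(1),\dots$ are mutually independent. Vector norms are Euclidean, matrix norms are the induced norms, and $'$ is the transpose. Put $\mu_w=\sum_i p_iw_i$, $Q_w=\sum_i p_iw_iw_i'$, $C_w=Q_w-\mu_w\mu_w'$, $\bar Q_v=C^{-1}Q_v(C^{-1})'$. For a horizon $T\ge 0$ and a causal output-feedback policy $u$ ($u(t)$ is a function of $y(0),\dots,y(t),u(0),\dots,u(t-1)$) let $$J_T(u)=\sum_{t=0}^{T}E[x(t)'Q(t)x(t)+u(t)'R(t)u(t)]+E[x(T+1)'P_{T+1}x(T+1)],$$ where $Q(t)\ge0$,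 $R(t)>0$, $P_{T+1}\ge0$ are symmetric. Let $P_T(T+1)=P_{T+1}$, $L_T(T+1)=0$ and, for $t=T,T-1,\dots,0$, $$\Upsilon_T(t)=R(t)+B'P_T(t+1)B,$$ $$P_T(t)=A'P_T(t+1)A+Q(t)-A'P_T(t+1)B\Upsilon_T(t)^{-1}B'P_T(t+1)A,$$ $$L_T(t)=\big(A'-A'P_T(t+1)B\Upsilon_T(t)^{-1}B'\big)\big(P_T(t+1)+L_T(t+1)\big),$$ $$D_T(t)=(P_T(t+1)+L_T(t+1))'B\Upsilon_T(t)^{-1}B'(P_T(t+1)+L_T(t+1)),$$ $$H_T=\sum_{t=0}^T\Big\{-\mu_w'D_T(t)\mu_w+2\mu_w'L_T(t+1)\mu_w+\mathrm{Tr}\big(A'P_T(t+1)B\Upsilon_T(t)^{-1}B'P_T(t+1)A\bar Q_v\big)+\mathrm{Tr}(P_T(t+1)Q_w)\Big\}-\mathrm{Tr}(P_T(0)\bar Q_v).$$ Let $\hat x(t)=C^{-1}y(t)$. The offline policy, which knows $(p_i)$, is $$u_a(t)=-\Upsilon_T(t)^{-1}\big(B'P_T(t+1)A\hat x(t)+B'P_T(t+1)\mu_w+B'L_T(t+1)\mu_w\big).$$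 The learning policy $\hat u_a$, which does not know $(p_i)$, is obtained from the same formula by replacing $\mu_w$ by $\hat\mu_w(t)=\sum_i\hat p_i(t)w_i$, where $\hat p_i(0)=0$ and, for $t\ge1$, $\hat p_i(t)=\frac1t\#\{s<t:h(s)=i\}$ with $h(s)\in\arg\min_i\|\hat w(s)-w_i\|$ and $\hat w(s)=\hat x(s+1)-A\hat x(s)-Bu(s)$. Assume (H3): $\|w_i-w_j\|>2(1+\|A\|)\,\|C^{-1}\|\,v_b$ for all $i\ne j$. Then the following hold. 1. Under $\hat u_a$, almost surely, for all $t$, the minimizers of $i\mapsto\|\hat w(t)-w_i\|$ are exactly the $i$ with $w(t)=w_i$. Hence $\hat p_i(t)=\frac1t\#\{s<t:w(s)=w_i\}$ for $t\ge1$. 2. For every $T$ one has $D_T(t)\ge0$ for $0\le t\le T$, all expectations in $J_T(\hat u_a)$ are finite, and $$J_T(\hat u_a)=E\big[\hat x(0)'P_T(0)\hat x(0)+2\hat x(0)'L_T(0)\mu_w\big]+H_T+\mathrm{Tr}(D_T(0)\mu_w\mu_w')+\sum_{t=1}^T\frac1t\mathrm{Tr}(D_T(t)C_w).$$ 3. For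 every $T$, all expectations in $J_T(u_a)$ are finite, and the quasi-regret is $$J_T(\hat u_a)-J_T(u_a)=\mathrm{Tr}(D_T(0)\mu_w\mu_w')+\sum_{t=1}^T\frac1t\mathrm{Tr}(D_T(t)C_w).$$ 4. If moreover (H1) $Q(t)=Q$ and $R(t)=R$ for all $t$, and $P_{T+1}=0$ for all $T$, and (H2) $(A,B)$ is stabilizable and $(A,Q^{1/2})$ is observable, then $J_T(\hat u_a)-J_T(u_a)=O(\ln T)$ as $T\to\infty$. -/

import Mathlib

open MeasureTheory ProbabilityTheory Filter Topology Matrix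

noncomputable section

namespace OutputFeedback

/-- The Euclidean norm of a vector (not the sup norm that the type `Fin n → ℝ` carries). -/
def vecNorm {n : ℕ} (z : Fin n → ℝ) : ℝ := ‖WithLp.toLp 2 z‖

/-- The operator norm of a square matrix with respect to the Euclidean norm. -/
def opNorm {n : ℕ} (A : Matrix (Fin n) (Fin n) ℝ) : ℝ :=
  ‖Matrix.toEuclideanCLM (n := Fin n) (𝕜 := ℝ) A‖

/-- The data known to the decision maker: the system matrices `A`, `B`, `C`, the weights `Q(t)`,
`R(t)`, the terminal weight (`Pterm T` is the matrix `P_{T+1}` for horizon `T`) and the possible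
values `w_1, …, w_M` of the system noise. The probabilities of these values are not part of it. -/
structure Model (n m M : ℕ) where
  A : Matrix (Fin n) (Fin n) ℝ
  B : Matrix (Fin n) (Fin m) ℝ
  C : Matrix (Fin n) (Fin n) ℝ
  Q : ℕ → Matrix (Fin n) (Fin n) ℝ
  R : ℕ → Matrix (Fin m) (Fin m) ℝ
  Pterm : ℕ → Matrix (Fin n) (Fin n) ℝ
  atom : Fin M → Fin n → ℝ

variable {n m M : ℕ}

/-! Riccati and adjoint recursions, backwards in time from `T + 1`. -/

/-- `P_T(t)`: the Riccati recursion for `t ≤ T`, with `P_T(T+1) = P_{T+1}`. -/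
def riccati (D : Model n m M) (T t : ℕ) : Matrix (Fin n) (Fin n) ℝ :=
  if t ≤ T then
    D.Aᵀ * riccati D T (t + 1) * D.A + D.Q t
      - D.Aᵀ * riccati D T (t + 1) * D.B
        * (D.R t + D.Bᵀ * riccati D T (t + 1) * D.B)⁻¹ * D.Bᵀ * riccati D T (t + 1) * D.A
  else D.Pterm T
termination_by T + 1 - t

/-- `Υ_T(t) = R(t) + B' P_T(t+1) B`. -/
def upsilon (D : Model n m M) (T t : ℕ) : Matrix (Fin m) (Fin m) ℝ :=
  D.R t + D.Bᵀ * riccati D T (t + 1) * D.B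

/-- `L_T(t) = (A' - A' P_T(t+1) B Υ_T(t)⁻¹ B') (P_T(t+1) + L_T(t+1))` for `t ≤ T`,
with `L_T(T+1) = 0`. -/
def adjointL (D : Model n m M) (T t : ℕ) : Matrix (Fin n) (Fin n) ℝ :=
  if t ≤ T then
    (D.Aᵀ - D.Aᵀ * riccati D T (t + 1) * D.B * (upsilon D T t)⁻¹ * D.Bᵀ)
      * (riccati D T (t + 1) + adjointL D T (t + 1))
  else 0
termination_by T + 1 - t

/-- `D_T(t) = (P_T(t+1) + L_T(t+1))' B Υ_T(t)⁻¹ B' (P_T(t+1) + L_T(t+1))`. -/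
def dMat (D : Model n m M) (T t : ℕ) : Matrix (Fin n) (Fin n) ℝ :=
  (riccati D T (t + 1) + adjointL D T (t + 1))ᵀ * D.B * (upsilon D T t)⁻¹ * D.Bᵀ
    * (riccati D T (t + 1) + adjointL D T (t + 1))

/-! Policies and closed loops. -/

/-- A causal output-feedback policy: at time `t` the input is a function of the measurements
`y(0), …, y(t)` and of the past inputs `u(0), …, u(t-1)`. -/
abbrev Policy (n m : ℕ) : Type :=
  (t : ℕ) → (Fin (t + 1) → Fin n → ℝ) → (Fin t → Fin m → ℝ) → Fin m → ℝ

/-- One run of the closed loop, for an initial state `x₀` and noise sequences `w`, `v`: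
`x(t)` together with the past measurements `y(0), …, y(t-1)` and inputs `u(0), …, u(t-1)`. -/
def run (D : Model n m M) (π : Policy n m) (x₀ : Fin n → ℝ) (w v : ℕ → Fin n → ℝ) :
    (t : ℕ) → (Fin n → ℝ) × (Fin t → Fin n → ℝ) × (Fin t → Fin m → ℝ)
  | 0 => (x₀, Fin.elim0, Fin.elim0)
  | t + 1 =>
    let r := run D π x₀ w v t
    let y : Fin (t + 1) → Fin n → ℝ := Fin.snoc (α := fun _ => Fin n → ℝ) r.2.1 (D.C *ᵥ r.1 + v t)
    let u : Fin m → ℝ := π t y r.2.2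
    (D.A *ᵥ r.1 + D.B *ᵥ u + w t, y, Fin.snoc (α := fun _ => Fin m → ℝ) r.2.2 u)

variable {Ω : Type*}

/-- The state process `x(t)` under the policy `π`. -/
def state (D : Model n m M) (π : Policy n m) (x₀ : Ω → Fin n → ℝ) (w v : ℕ → Ω → Fin n → ℝ)
    (t : ℕ) (ω : Ω) : Fin n → ℝ :=
  (run D π (x₀ ω) (fun s => w s ω) (fun s => v s ω) t).1

/-- The measurement process `y(t) = C x(t) + v(t)` under the policy `π`. -/
def output (D : Model n m M) (π : Policy n m) (x₀ : Ω → Fin n → ℝ) (w v : ℕ → Ω → Fin n → ℝ)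
    (t : ℕ) (ω : Ω) : Fin n → ℝ :=
  D.C *ᵥ state D π x₀ w v t ω + v t ω

/-- The input process `u(t)` under the policy `π`. -/
def input (D : Model n m M) (π : Policy n m) (x₀ : Ω → Fin n → ℝ) (w v : ℕ → Ω → Fin n → ℝ)
    (t : ℕ) (ω : Ω) : Fin m → ℝ :=
  (run D π (x₀ ω) (fun s => w s ω) (fun s => v s ω) (t + 1)).2.2 (Fin.last t)

/-- The one-step state estimate `x̂(t) = C⁻¹ y(t)` under the policy `π`. -/
def stateEst (D : Model n m M) (π : Policy n m) (x₀ : Ω → Fin n → ℝ) (w v : ℕ → Ω → Fin n → ℝ)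
    (t : ℕ) (ω : Ω) : Fin n → ℝ :=
  D.C⁻¹ *ᵥ output D π x₀ w v t ω

/-- `ŵ(t) = x̂(t+1) - A x̂(t) - B u(t)` under the policy `π`. -/
def noiseEst (D : Model n m M) (π : Policy n m) (x₀ : Ω → Fin n → ℝ) (w v : ℕ → Ω → Fin n → ℝ)
    (t : ℕ) (ω : Ω) : Fin n → ℝ :=
  stateEst D π x₀ w v (t + 1) ω - D.A *ᵥ stateEst D π x₀ w v t ω - D.B *ᵥ input D π x₀ w v t ω

theorem run_outputs (D : Model n m M) (π : Policy n m) (x₀ : Ω → Fin n → ℝ)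
    (w v : ℕ → Ω → Fin n → ℝ) (t : ℕ) (ω : Ω) :
    (run D π (x₀ ω) (fun s => w s ω) (fun s => v s ω) t).2.1
      = fun s : Fin t => output D π x₀ w v s ω := by
  induction t with
  | zero => funext s; exact s.elim0
  | succ t ih =>
    funext s
    refine Fin.lastCases ?_ (fun s => ?_) s
    · simp [run, output, state]
    · simp [run, ih]

theorem run_inputs (D : Model n m M) (π : Policy n m) (x₀ : Ω → Fin n → ℝ)
    (w v : ℕ → Ω → Fin n → ℝ) (t : ℕ) (ω : Ω) :
    (run D π (x₀ ω) (fun s => w s ω) (fun s => v s ω) t).2.2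
      = fun s : Fin t => input D π x₀ w v s ω := by
  induction t with
  | zero => funext s; exact s.elim0
  | succ t ih =>
    funext s
    refine Fin.lastCases ?_ (fun s => ?_) s
    · simp [input]
    · simp [run, ih]

/-- The initial condition `x(0) = x₀` of the closed loop. -/
theorem state_zero (D : Model n m M) (π : Policy n m) (x₀ : Ω → Fin n → ℝ)
    (w v : ℕ → Ω → Fin n → ℝ) (ω : Ω) : state D π x₀ w v 0 ω = x₀ ω := rfl

/-- The input of the closed loop is the policy applied to the observed history. -/
theorem input_eq (D : Model n m M) (π : Policy n m) (x₀ : Ω → Fin n → ℝ)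
    (w v : ℕ → Ω → Fin n → ℝ) (t : ℕ) (ω : Ω) :
    input D π x₀ w v t ω = π t (fun s => output D π x₀ w v s ω)
      (fun s => input D π x₀ w v s ω) := by
  rw [← run_outputs, ← run_inputs]
  simp [input, run]

/-- The state equation `x(t+1) = A x(t) + B u(t) + w(t)` of the closed loop. -/
theorem state_succ (D : Model n m M) (π : Policy n m) (x₀ : Ω → Fin n → ℝ)
    (w v : ℕ → Ω → Fin n → ℝ) (t : ℕ) (ω : Ω) :
    state D π x₀ w v (t + 1) ω
      = D.A *ᵥ state D π x₀ w v t ω + D.B *ᵥ input D π x₀ w v t ω + w t ω := by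
  simp [state, input, run]

/-! The two policies. -/

/-- `-Υ_T(t)⁻¹ (B' P_T(t+1) A x̂ + B' P_T(t+1) μ + B' L_T(t+1) μ)`. -/
def feedback (D : Model n m M) (T t : ℕ) (xhat μ : Fin n → ℝ) : Fin m → ℝ :=
  -((upsilon D T t)⁻¹ *ᵥ
    ((D.Bᵀ * riccati D T (t + 1) * D.A) *ᵥ xhat + (D.Bᵀ * riccati D T (t + 1)) *ᵥ μ
      + (D.Bᵀ * adjointL D T (t + 1)) *ᵥ μ))

/-- The index of a value `w_i` nearest to `z` in Euclidean distance (`argmin_i ‖z - w_i‖`). -/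
def nearestIndex [NeZero M] (a : Fin M → Fin n → ℝ) (z : Fin n → ℝ) : Fin M :=
  Classical.choose (Finite.exists_min fun i => vecNorm (z - a i))

theorem nearestIndex_spec [NeZero M] (a : Fin M → Fin n → ℝ) (z : Fin n → ℝ) (i : Fin M) :
    vecNorm (z - a (nearestIndex a z)) ≤ vecNorm (z - a i) :=
  Classical.choose_spec (Finite.exists_min fun i => vecNorm (z - a i)) i

/-- The estimate `(1/t) ∑_{s<t} ξ_{h(s)}` of the probability vector from observed indices
`h(0), …, h(t-1)`, where `ξ_i` is the `i`-th unit vector; it is `0` for `t = 0`. -/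
def probEst {t : ℕ} (h : Fin t → Fin M) : Fin M → ℝ :=
  (1 / (t : ℝ)) • ∑ s : Fin t, (Pi.single (h s) 1 : Fin M → ℝ)

/-- `W p = ∑ i, p_i w_i`; this is `μ_w` if `p` is the vector of noise probabilities. -/
def meanOf (a : Fin M → Fin n → ℝ) (p : Fin M → ℝ) : Fin n → ℝ := ∑ i, p i • a i

/-- The estimate of the noise probabilities at time `t`, computed from the observed history: each
`ŵ(s) = C⁻¹ y(s+1) - A C⁻¹ y(s) - B u(s)` with `s < t` is replaced by the nearest `w_i`. -/
def historyProbEst [NeZero M] (D : Model n m M) (t : ℕ) (y : Fin (t + 1) → Fin n → ℝ)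
    (u : Fin t → Fin m → ℝ) : Fin M → ℝ :=
  probEst fun s : Fin t =>
    nearestIndex D.atom (D.C⁻¹ *ᵥ y s.succ - D.A *ᵥ (D.C⁻¹ *ᵥ y s.castSucc) - D.B *ᵥ u s)

/-- The learning policy `û_a` for horizon `T`; it does not know the noise probabilities. -/
def learningPolicy [NeZero M] (D : Model n m M) (T : ℕ) : Policy n m := fun t y u =>
  feedback D T t (D.C⁻¹ *ᵥ y (Fin.last t)) (meanOf D.atom (historyProbEst D t y u))

/-- The suboptimal offline policy `u_a` for horizon `T`, which knows the probabilities `p`. -/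
def offlinePolicy (D : Model n m M) (p : Fin M → ℝ) (T : ℕ) : Policy n m := fun t y _ =>
  feedback D T t (D.C⁻¹ *ᵥ y (Fin.last t)) (meanOf D.atom p)

/-! Cost. -/

/-- `x(t)' Q(t) x(t) + u(t)' R(t) u(t)`. -/
def stageCost (D : Model n m M) (π : Policy n m) (x₀ : Ω → Fin n → ℝ) (w v : ℕ → Ω → Fin n → ℝ)
    (t : ℕ) (ω : Ω) : ℝ :=
  state D π x₀ w v t ω ⬝ᵥ (D.Q t *ᵥ state D π x₀ w v t ω)
    + input D π x₀ w v t ω ⬝ᵥ (D.R t *ᵥ input D π x₀ w v t ω)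

/-- `x(T+1)' P_{T+1} x(T+1)`. -/
def terminalCost (D : Model n m M) (π : Policy n m) (x₀ : Ω → Fin n → ℝ)
    (w v : ℕ → Ω → Fin n → ℝ) (T : ℕ) (ω : Ω) : ℝ :=
  state D π x₀ w v (T + 1) ω ⬝ᵥ (D.Pterm T *ᵥ state D π x₀ w v (T + 1) ω)

/-- All expectations in the cost of horizon `T` are expectations of integrable variables. -/
def CostIntegrable [MeasurableSpace Ω] (P : Measure Ω) (D : Model n m M) (π : Policy n m)
    (x₀ : Ω → Fin n → ℝ) (w v : ℕ → Ω → Fin n → ℝ) (T : ℕ) : Prop :=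
  (∀ t ≤ T, Integrable (stageCost D π x₀ w v t) P) ∧ Integrable (terminalCost D π x₀ w v T) P

/-- The expected cost `J_T` of the policy `π`. -/
def cost [MeasurableSpace Ω] (P : Measure Ω) (D : Model n m M) (π : Policy n m)
    (x₀ : Ω → Fin n → ℝ) (w v : ℕ → Ω → Fin n → ℝ) (T : ℕ) : ℝ :=
  ∑ t ∈ Finset.range (T + 1), ∫ ω, stageCost D π x₀ w v t ω ∂P
    + ∫ ω, terminalCost D π x₀ w v T ω ∂P

/-- The quasi-regret of the learning policy: its cost minus that of the offline policy. -/
def quasiRegret [NeZero M] [MeasurableSpace Ω] (P : Measure Ω) (D : Model n m M) (p : Fin M → ℝ)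
    (x₀ : Ω → Fin n → ℝ) (w v : ℕ → Ω → Fin n → ℝ) (T : ℕ) : ℝ :=
  cost P D (learningPolicy D T) x₀ w v T - cost P D (offlinePolicy D p T) x₀ w v T

/-! Second-order statistics and the constant in the cost formula. -/

/-- `Q_w = ∑ i, p_i w_i w_i'`. -/
def secondMoment (a : Fin M → Fin n → ℝ) (p : Fin M → ℝ) : Matrix (Fin n) (Fin n) ℝ :=
  ∑ i, p i • vecMulVec (a i) (a i)

/-- `C_w = Q_w - μ_w μ_w'`. -/
def covariance (a : Fin M → Fin n → ℝ) (p : Fin M → ℝ) : Matrix (Fin n) (Fin n) ℝ :=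
  secondMoment a p - vecMulVec (meanOf a p) (meanOf a p)

/-- `E[z z']` for a random vector `z`. -/
def momentMatrix [MeasurableSpace Ω] (P : Measure Ω) (z : Ω → Fin n → ℝ) :
    Matrix (Fin n) (Fin n) ℝ :=
  Matrix.of fun i j => ∫ ω, z ω i * z ω j ∂P

/-- The constant `H_T` of the cost formula, where `Qbar = C⁻¹ Q_v (C⁻¹)'`. -/
def hConst (D : Model n m M) (p : Fin M → ℝ) (Qbar : Matrix (Fin n) (Fin n) ℝ) (T : ℕ) : ℝ :=
  ∑ t ∈ Finset.range (T + 1),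
    (-(meanOf D.atom p ⬝ᵥ (dMat D T t *ᵥ meanOf D.atom p))
      + 2 * (meanOf D.atom p ⬝ᵥ (adjointL D T (t + 1) *ᵥ meanOf D.atom p))
      + (D.Aᵀ * riccati D T (t + 1) * D.B * (upsilon D T t)⁻¹ * D.Bᵀ * riccati D T (t + 1) * D.A
          * Qbar).trace
      + (riccati D T (t + 1) * secondMoment D.atom p).trace)
    - (riccati D T 0 * Qbar).trace

/-! Stabilizability and observability. -/

/-- `(A, B)` is stabilizable: some linear state feedback `u = K z` makes
`z(t+1) = (A + B K) z(t)` asymptotically stable. -/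
def Stabilizable (A : Matrix (Fin n) (Fin n) ℝ) (B : Matrix (Fin n) (Fin m) ℝ) : Prop :=
  ∃ K : Matrix (Fin m) (Fin n) ℝ, ∀ z : Fin n → ℝ,
    Tendsto (fun k : ℕ => ((A + B * K) ^ k) *ᵥ z) atTop (𝓝 0)

/-- `(A, S)` is observable: only the zero initial state of `z(t+1) = A z(t)` has the output
`S z(t)` equal to zero at all times. -/
def Observable (A S : Matrix (Fin n) (Fin n) ℝ) : Prop :=
  ∀ z : Fin n → ℝ, (∀ k : ℕ, S *ᵥ ((A ^ k) *ᵥ z) = 0) → z = 0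

end OutputFeedback

end

/-! ### The Riccati map, the backward recursions and the one-step algebra. -/

namespace OutputFeedback

variable {n m M : ℕ}

/-! Identification. The input cancels in `ŵ(t)`, leaving `w(t)` plus a combination of two
measurement noises of norm at most `(1+‖A‖)‖C⁻¹‖v_b`. This is less than half the distance between
two atoms, so almost surely the nearest atom is the true one (`minimizer_iff`), and the estimated
mean is the sample mean of `w(0), …, w(t-1)`. Although computed from noisy outputs, it does not
depend on the measurement noise.

Cost. Both policies are therefore instances of one closed loop `loopState`, in which the feedback
uses some `ν t` depending only on the past instead of `μ_w`: the sample mean for the learning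
policy, `μ_w` itself for the offline one. The quadratic function `x̂'P_T(t)x̂ + 2x̂'L_T(t)μ_w` of
the estimate serves as value function. Completing the square in `u(t)` shows that using `ν` instead
of `μ_w` costs exactly `(μ_w-ν)'D_T(t)(μ_w-ν)`. The cross terms are removed by independence, except
that `u(t)` depends on `v(t)` through `x̂(t)`; this produces the trace with `Q̄_v` in `H_T`. The
resulting identity `stage_value_step` telescopes to `loop_cost`. The extra cost is zero for the
offline policy. For the sample mean it is `μ_w'D_T(0)μ_w` at time 0 and, the `w(s)` being
uncorrelated, `Tr(D_T(t)C_w)/t` afterwards (`integral_sampleMean_error`).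

Growth. With constant weights and zero terminal weight, `D_T(t)` depends only on `T - t`, so a
harmonic sum gives `ln T` once one sequence of matrices is bounded. The Riccati iterates from 0
increase and are dominated by the cost of a stabilizing feedback, so they converge to a fixed point.
Its closed loop is stable by LaSalle's principle and observability (`closedLoop_stable`). The
adjoint iterates then satisfy a linear recursion whose coefficients converge to a stable matrix,
hence are bounded (`adjointIter_bounded`). -/

theorem mulVec_dotProduct_transpose {k l : ℕ} (N : Matrix (Fin k) (Fin l) ℝ) (x : Fin l → ℝ)
    (y : Fin k → ℝ) : (N *ᵥ x) ⬝ᵥ y = x ⬝ᵥ (Nᵀ *ᵥ y) := by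
  rw [dotProduct_mulVec, vecMul_transpose]

theorem dotProduct_mulVec_swap {k l : ℕ} (N : Matrix (Fin k) (Fin l) ℝ) (x : Fin k → ℝ)
    (y : Fin l → ℝ) : x ⬝ᵥ (N *ᵥ y) = y ⬝ᵥ (Nᵀ *ᵥ x) := by
  rw [dotProduct_comm, mulVec_dotProduct_transpose]

/-- The right-hand side of the Riccati recursion. -/
noncomputable def riccatiMap (A : Matrix (Fin n) (Fin n) ℝ) (B : Matrix (Fin n) (Fin m) ℝ)
    (Q : Matrix (Fin n) (Fin n) ℝ) (R : Matrix (Fin m) (Fin m) ℝ) (P : Matrix (Fin n) (Fin n) ℝ) :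
    Matrix (Fin n) (Fin n) ℝ :=
  Aᵀ * P * A + Q - Aᵀ * P * B * (R + Bᵀ * P * B)⁻¹ * Bᵀ * P * A

/-- The feedback gain `(R + B' P B)⁻¹ B' P A` of the Riccati recursion. -/
noncomputable def riccatiGain (A : Matrix (Fin n) (Fin n) ℝ) (B : Matrix (Fin n) (Fin m) ℝ)
    (R : Matrix (Fin m) (Fin m) ℝ) (P : Matrix (Fin n) (Fin n) ℝ) : Matrix (Fin m) (Fin n) ℝ :=
  (R + Bᵀ * P * B)⁻¹ * (Bᵀ * P * A)

section RiccatiMap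

variable {A : Matrix (Fin n) (Fin n) ℝ} {B : Matrix (Fin n) (Fin m) ℝ}
  {Q P : Matrix (Fin n) (Fin n) ℝ} {R : Matrix (Fin m) (Fin m) ℝ}

theorem posSemidef_transpose_mul_mul {k l : ℕ} {P : Matrix (Fin k) (Fin k) ℝ} (hP : P.PosSemidef)
    (B : Matrix (Fin k) (Fin l) ℝ) : (Bᵀ * P * B).PosSemidef := by
  simpa using hP.conjTranspose_mul_mul_same B

theorem posSemidef_transpose_eq {k : ℕ} {P : Matrix (Fin k) (Fin k) ℝ} (hP : P.PosSemidef) :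
    Pᵀ = P := by
  simpa [IsHermitian] using hP.isHermitian

theorem posSemidef_quadratic_nonneg {k : ℕ} {P : Matrix (Fin k) (Fin k) ℝ} (hP : P.PosSemidef)
    (x : Fin k → ℝ) : 0 ≤ x ⬝ᵥ (P *ᵥ x) := by
  simpa using hP.dotProduct_mulVec_nonneg x

theorem inputWeight_posDef (hP : P.PosSemidef) (hR : R.PosDef) (B : Matrix (Fin n) (Fin m) ℝ) :
    (R + Bᵀ * P * B).PosDef :=
  hR.add_posSemidef (posSemidef_transpose_mul_mul hP B)

/-- Completion of squares for a linear feedback. -/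
theorem riccatiMap_completion (hP : P.PosSemidef) (hR : R.PosDef)
    (A : Matrix (Fin n) (Fin n) ℝ) (B : Matrix (Fin n) (Fin m) ℝ) (Q : Matrix (Fin n) (Fin n) ℝ)
    (K : Matrix (Fin m) (Fin n) ℝ) :
    (A - B * K)ᵀ * P * (A - B * K) + Q + Kᵀ * R * K
      = riccatiMap A B Q R P
        + (K - riccatiGain A B R P)ᵀ * (R + Bᵀ * P * B) * (K - riccatiGain A B R P) := by
  have hΥ := inputWeight_posDef hP hR B
  have hdet : IsUnit (R + Bᵀ * P * B).det := (isUnit_iff_isUnit_det _).1 hΥ.isUnit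
  have hΥt : (R + Bᵀ * P * B)ᵀ = R + Bᵀ * P * B := posSemidef_transpose_eq hΥ.posSemidef
  have hPt := posSemidef_transpose_eq hP
  have h1 : (R + Bᵀ * P * B) * riccatiGain A B R P = Bᵀ * P * A :=
    mul_nonsing_inv_cancel_left _ _ hdet
  have h2 : (riccatiGain A B R P)ᵀ * (R + Bᵀ * P * B) = Aᵀ * P * B := by
    rw [← Matrix.transpose_transpose ((riccatiGain A B R P)ᵀ * (R + Bᵀ * P * B)),
      transpose_mul, transpose_transpose, hΥt, h1]
    simp [transpose_mul, hPt, Matrix.mul_assoc]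
  have h3 : riccatiMap A B Q R P = Aᵀ * P * A + Q - Aᵀ * P * B * riccatiGain A B R P := by
    simp only [riccatiMap, riccatiGain, Matrix.mul_assoc]
  have h4 : (K - riccatiGain A B R P)ᵀ * (R + Bᵀ * P * B) * (K - riccatiGain A B R P)
      = Kᵀ * (R + Bᵀ * P * B) * K - Kᵀ * (Bᵀ * P * A) - Aᵀ * P * B * K
        + Aᵀ * P * B * riccatiGain A B R P := by
    rw [transpose_sub, Matrix.sub_mul, h2, Matrix.sub_mul, Matrix.mul_sub, Matrix.mul_sub,
      Matrix.mul_assoc Kᵀ _ (riccatiGain A B R P), h1]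
    abel
  rw [h3, h4]
  simp only [transpose_sub, transpose_mul, Matrix.sub_mul, Matrix.mul_sub, Matrix.mul_add,
    Matrix.add_mul, Matrix.mul_assoc]
  abel

/-- The optimal gain annihilates the square in `riccatiMap_completion`. In this form, unlike in the
definition with its minus sign, positive semidefiniteness is visible. -/
theorem riccatiMap_eq_closedLoop (hP : P.PosSemidef) (hR : R.PosDef)
    (A : Matrix (Fin n) (Fin n) ℝ) (B : Matrix (Fin n) (Fin m) ℝ) (Q : Matrix (Fin n) (Fin n) ℝ) :
    riccatiMap A B Q R P = (A - B * riccatiGain A B R P)ᵀ * P * (A - B * riccatiGain A B R P) + Q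
      + (riccatiGain A B R P)ᵀ * R * riccatiGain A B R P := by
  rw [riccatiMap_completion hP hR]; simp

theorem riccatiMap_posSemidef (hP : P.PosSemidef) (hR : R.PosDef) (hQ : Q.PosSemidef)
    (A : Matrix (Fin n) (Fin n) ℝ) (B : Matrix (Fin n) (Fin m) ℝ) :
    (riccatiMap A B Q R P).PosSemidef := by
  rw [riccatiMap_eq_closedLoop hP hR]
  exact ((posSemidef_transpose_mul_mul hP _).add hQ).add
    (posSemidef_transpose_mul_mul hR.posSemidef _)

end RiccatiMap

section Recursions

variable (D : Model n m M)

theorem riccati_of_le {T t : ℕ} (h : t ≤ T) :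
    riccati D T t = riccatiMap D.A D.B (D.Q t) (D.R t) (riccati D T (t + 1)) := by
  rw [riccati, if_pos h]; rfl

theorem riccati_of_lt {T t : ℕ} (h : T < t) : riccati D T t = D.Pterm T := by
  rw [riccati, if_neg (by omega)]

theorem adjointL_of_lt {T t : ℕ} (h : T < t) : adjointL D T t = 0 := by
  rw [adjointL, if_neg (by omega)]

theorem adjointL_of_le {T t : ℕ} (h : t ≤ T) :
    adjointL D T t = (D.Aᵀ - D.Aᵀ * riccati D T (t + 1) * D.B * (upsilon D T t)⁻¹ * D.Bᵀ)
      * (riccati D T (t + 1) + adjointL D T (t + 1)) := by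
  rw [adjointL, if_pos h]

variable {D}

theorem riccati_posSemidef (hQ : ∀ t, (D.Q t).PosSemidef) (hR : ∀ t, (D.R t).PosDef)
    (hPterm : ∀ T, (D.Pterm T).PosSemidef) (T t : ℕ) : (riccati D T t).PosSemidef := by
  by_cases h : t ≤ T
  · induction h using Nat.decreasingInduction with
    | self =>
      rw [riccati_of_le D le_rfl, riccati_of_lt D (Nat.lt_succ_self T)]
      exact riccatiMap_posSemidef (hPterm T) (hR T) (hQ T) _ _
    | of_succ k hk ih =>
      rw [riccati_of_le D hk.le]
      exact riccatiMap_posSemidef ih (hR k) (hQ k) _ _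
  · rw [riccati_of_lt D (by omega)]; exact hPterm T

theorem upsilon_posDef (hQ : ∀ t, (D.Q t).PosSemidef) (hR : ∀ t, (D.R t).PosDef)
    (hPterm : ∀ T, (D.Pterm T).PosSemidef) (T t : ℕ) : (upsilon D T t).PosDef :=
  inputWeight_posDef (riccati_posSemidef hQ hR hPterm T (t + 1)) (hR t) D.B

theorem dMat_posSemidef (hQ : ∀ t, (D.Q t).PosSemidef) (hR : ∀ t, (D.R t).PosDef)
    (hPterm : ∀ T, (D.Pterm T).PosSemidef) (T t : ℕ) : (dMat D T t).PosSemidef := by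
  have h := posSemidef_transpose_mul_mul (upsilon_posDef hQ hR hPterm T t).inv.posSemidef
    (D.Bᵀ * (riccati D T (t + 1) + adjointL D T (t + 1)))
  simpa only [dMat, transpose_mul, transpose_transpose, Matrix.mul_assoc] using h

end Recursions

section OneStep

variable {A : Matrix (Fin n) (Fin n) ℝ} {B : Matrix (Fin n) (Fin m) ℝ}
  {Q P L : Matrix (Fin n) (Fin n) ℝ} {R : Matrix (Fin m) (Fin m) ℝ}

/-- Expansion of the stage cost plus the cost-to-go at the next estimate. -/
theorem stage_expansion (hP : Pᵀ = P) (hQ : Qᵀ = Q)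
    (x e w e' μ : Fin n → ℝ) (u : Fin m → ℝ) :
    x ⬝ᵥ (Q *ᵥ x) + u ⬝ᵥ (R *ᵥ u)
      + ((A *ᵥ x + B *ᵥ u + w + e') ⬝ᵥ (P *ᵥ (A *ᵥ x + B *ᵥ u + w + e'))
        + 2 * ((A *ᵥ x + B *ᵥ u + w + e') ⬝ᵥ (L *ᵥ μ)))
    = ((x + e) ⬝ᵥ ((Aᵀ * P * A + Q) *ᵥ (x + e)) + u ⬝ᵥ ((R + Bᵀ * P * B) *ᵥ u)
        + 2 * (u ⬝ᵥ ((Bᵀ * P * A) *ᵥ (x + e))) + 2 * (u ⬝ᵥ ((Bᵀ * (P + L)) *ᵥ μ))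
        + 2 * ((x + e) ⬝ᵥ ((Aᵀ * (P + L)) *ᵥ μ)))
      + w ⬝ᵥ (P *ᵥ w) + e' ⬝ᵥ (P *ᵥ e') + 2 * (w ⬝ᵥ (L *ᵥ μ))
      - e ⬝ᵥ ((Aᵀ * P * A + Q) *ᵥ e) - 2 * (u ⬝ᵥ ((Bᵀ * P * A) *ᵥ e))
      + (2 * ((A *ᵥ x + B *ᵥ u) ⬝ᵥ (P *ᵥ (w - μ)))
        + 2 * ((A *ᵥ x + B *ᵥ u + w) ⬝ᵥ (P *ᵥ e')) + 2 * ((L *ᵥ μ) ⬝ᵥ e')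
        - 2 * (x ⬝ᵥ ((Aᵀ * P * A + Q) *ᵥ e)) - 2 * (((Aᵀ * (P + L)) *ᵥ μ) ⬝ᵥ e)) := by
  -- Symmetry and transposition bring every bilinear term to one orientation, so that `ring` can
  -- match them as atoms.
  have sw : ∀ y z : Fin n → ℝ, y ⬝ᵥ (P *ᵥ z) = z ⬝ᵥ (P *ᵥ y) := fun y z => by
    rw [dotProduct_mulVec_swap, hP]
  have sq : e ⬝ᵥ (Q *ᵥ x) = x ⬝ᵥ (Q *ᵥ e) := by rw [dotProduct_mulVec_swap, hQ]
  have tA : ∀ y z : Fin n → ℝ, y ⬝ᵥ (Aᵀ *ᵥ z) = (A *ᵥ y) ⬝ᵥ z := fun y z =>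
    (mulVec_dotProduct_transpose _ _ _).symm
  have tB : ∀ (y : Fin m → ℝ) (z : Fin n → ℝ), y ⬝ᵥ (Bᵀ *ᵥ z) = (B *ᵥ y) ⬝ᵥ z := fun y z =>
    (mulVec_dotProduct_transpose _ _ _).symm
  simp only [← mulVec_mulVec, add_mulVec, mulVec_add, mulVec_sub, dotProduct_add, add_dotProduct,
    dotProduct_sub, tA, tB]
  rw [dotProduct_comm (Aᵀ *ᵥ P *ᵥ μ), dotProduct_comm (Aᵀ *ᵥ L *ᵥ μ), tA, tA,
    dotProduct_comm (L *ᵥ μ) e',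
    sw (A *ᵥ e) (A *ᵥ x), sw (B *ᵥ u) (A *ᵥ x), sw (B *ᵥ u) (A *ᵥ e), sw w (A *ᵥ x),
    sw w (B *ᵥ u), sw e' (A *ᵥ x), sw e' (B *ᵥ u), sw e' w, sq]
  ring

/-- Completion of squares with an affine term. -/
theorem affine_completion {Υ : Matrix (Fin m) (Fin m) ℝ} (hΥ : Υ.PosDef) (u : Fin m → ℝ)
    (g g' : Fin m → ℝ) (hu : u = -(Υ⁻¹ *ᵥ g')) :
    u ⬝ᵥ (Υ *ᵥ u) + 2 * (u ⬝ᵥ g)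
      = (g - g') ⬝ᵥ (Υ⁻¹ *ᵥ (g - g')) - g ⬝ᵥ (Υ⁻¹ *ᵥ g) := by
  have hdet : IsUnit Υ.det := (isUnit_iff_isUnit_det _).1 hΥ.isUnit
  have hs : Υ⁻¹ᵀ = Υ⁻¹ := posSemidef_transpose_eq hΥ.inv.posSemidef
  have sw : ∀ y z : Fin m → ℝ, y ⬝ᵥ (Υ⁻¹ *ᵥ z) = z ⬝ᵥ (Υ⁻¹ *ᵥ y) := fun y z => by
    rw [dotProduct_mulVec_swap, hs]
  subst hu
  simp only [mulVec_neg, mulVec_mulVec, mul_nonsing_inv _ hdet, one_mulVec, mulVec_sub,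
    neg_dotProduct, dotProduct_neg, sub_dotProduct, dotProduct_sub]
  rw [dotProduct_comm _ g', dotProduct_comm _ g, sw g' g]
  ring

/-- Apply `affine_completion` with the true linear term `g` and the one `g'` used by the feedback.
They differ by `B'(P+L)(μ-m')`, so the loss from the wrong mean is exactly the `D`-form of `μ-m'`.
-/
theorem stage_completion (hP : P.PosSemidef) (hR : R.PosDef) (ξ μ m' : Fin n → ℝ) (u : Fin m → ℝ)
    (hu : u = -((R + Bᵀ * P * B)⁻¹ *ᵥ
      ((Bᵀ * P * A) *ᵥ ξ + (Bᵀ * P) *ᵥ m' + (Bᵀ * L) *ᵥ m'))) :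
    ξ ⬝ᵥ ((Aᵀ * P * A + Q) *ᵥ ξ) + u ⬝ᵥ ((R + Bᵀ * P * B) *ᵥ u)
        + 2 * (u ⬝ᵥ ((Bᵀ * P * A) *ᵥ ξ)) + 2 * (u ⬝ᵥ ((Bᵀ * (P + L)) *ᵥ μ))
        + 2 * (ξ ⬝ᵥ ((Aᵀ * (P + L)) *ᵥ μ))
    = ξ ⬝ᵥ (riccatiMap A B Q R P *ᵥ ξ)
      + 2 * (ξ ⬝ᵥ (((Aᵀ - Aᵀ * P * B * (R + Bᵀ * P * B)⁻¹ * Bᵀ) * (P + L)) *ᵥ μ))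
      + (μ - m') ⬝ᵥ (((P + L)ᵀ * B * (R + Bᵀ * P * B)⁻¹ * Bᵀ * (P + L)) *ᵥ (μ - m'))
      - μ ⬝ᵥ (((P + L)ᵀ * B * (R + Bᵀ * P * B)⁻¹ * Bᵀ * (P + L)) *ᵥ μ) := by
  have hΥ := inputWeight_posDef hP hR B
  have hPt := posSemidef_transpose_eq hP
  have hs : (R + Bᵀ * P * B)⁻¹ᵀ = (R + Bᵀ * P * B)⁻¹ := posSemidef_transpose_eq hΥ.inv.posSemidef
  have h := affine_completion hΥ u ((Bᵀ * P * A) *ᵥ ξ + (Bᵀ * (P + L)) *ᵥ μ) _ hu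
  have e1 : (Bᵀ * P * A) *ᵥ ξ + (Bᵀ * (P + L)) *ᵥ μ
      - ((Bᵀ * P * A) *ᵥ ξ + (Bᵀ * P) *ᵥ m' + (Bᵀ * L) *ᵥ m') = (Bᵀ * (P + L)) *ᵥ (μ - m') := by
    rw [mulVec_sub, Matrix.mul_add, add_mulVec, add_mulVec]; abel
  rw [e1, dotProduct_add] at h
  have e2 : ∀ y : Fin n → ℝ, ((Bᵀ * (P + L)) *ᵥ y) ⬝ᵥ ((R + Bᵀ * P * B)⁻¹ *ᵥ ((Bᵀ * (P + L)) *ᵥ y))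
      = y ⬝ᵥ (((P + L)ᵀ * B * (R + Bᵀ * P * B)⁻¹ * Bᵀ * (P + L)) *ᵥ y) := fun y => by
    rw [mulVec_dotProduct_transpose]
    simp only [mulVec_mulVec, transpose_mul, transpose_transpose, Matrix.mul_assoc]
  rw [e2] at h
  -- The three pieces are the subtracted term of the Riccati map, the one of the adjoint recursion,
  -- and `μ'Dμ`.
  have e3 : ((Bᵀ * P * A) *ᵥ ξ + (Bᵀ * (P + L)) *ᵥ μ) ⬝ᵥ
        ((R + Bᵀ * P * B)⁻¹ *ᵥ ((Bᵀ * P * A) *ᵥ ξ + (Bᵀ * (P + L)) *ᵥ μ))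
      = ξ ⬝ᵥ ((Aᵀ * P * B * (R + Bᵀ * P * B)⁻¹ * Bᵀ * P * A) *ᵥ ξ)
        + 2 * (ξ ⬝ᵥ ((Aᵀ * P * B * (R + Bᵀ * P * B)⁻¹ * Bᵀ * (P + L)) *ᵥ μ))
        + μ ⬝ᵥ (((P + L)ᵀ * B * (R + Bᵀ * P * B)⁻¹ * Bᵀ * (P + L)) *ᵥ μ) := by
    have c : ∀ y : Fin m → ℝ, ((Bᵀ * P * A) *ᵥ ξ) ⬝ᵥ y = ξ ⬝ᵥ ((Aᵀ * P * B) *ᵥ y) := fun y => by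
      rw [mulVec_dotProduct_transpose]
      simp only [transpose_mul, transpose_transpose, Matrix.mul_assoc, hPt]
    rw [mulVec_add, dotProduct_add, add_dotProduct, add_dotProduct, e2,
      dotProduct_mulVec_swap (R + Bᵀ * P * B)⁻¹ ((Bᵀ * (P + L)) *ᵥ μ), hs, c, c]
    simp only [mulVec_mulVec, Matrix.mul_assoc]
    ring
  rw [e3] at h
  simp only [riccatiMap, sub_mulVec, dotProduct_sub, Matrix.sub_mul]
  linarith

/-- The feedback sees `x + e`, so it is correlated with the error `e`. Only the part quadratic in
`e` survives in expectation; the others pair `e` with `x` and `m'`, which will be independent of it.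
-/
theorem feedback_error_cross (hP : P.PosSemidef) (hR : R.PosDef) (x e m' : Fin n → ℝ)
    (u : Fin m → ℝ)
    (hu : u = -((R + Bᵀ * P * B)⁻¹ *ᵥ
      ((Bᵀ * P * A) *ᵥ (x + e) + (Bᵀ * P) *ᵥ m' + (Bᵀ * L) *ᵥ m'))) :
    u ⬝ᵥ ((Bᵀ * P * A) *ᵥ e)
      = -(e ⬝ᵥ ((Aᵀ * P * B * (R + Bᵀ * P * B)⁻¹ * Bᵀ * P * A) *ᵥ e))
        - x ⬝ᵥ ((Aᵀ * P * B * (R + Bᵀ * P * B)⁻¹ * Bᵀ * P * A) *ᵥ e)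
        - m' ⬝ᵥ (((P + Lᵀ) * B * (R + Bᵀ * P * B)⁻¹ * Bᵀ * P * A) *ᵥ e) := by
  have hΥ := inputWeight_posDef hP hR B
  have hPt := posSemidef_transpose_eq hP
  have hs : (R + Bᵀ * P * B)⁻¹ᵀ = (R + Bᵀ * P * B)⁻¹ := posSemidef_transpose_eq hΥ.inv.posSemidef
  generalize (R + Bᵀ * P * B)⁻¹ = Z at hs hu ⊢
  subst hu
  simp only [neg_dotProduct, mulVec_dotProduct_transpose, hs, add_dotProduct, mulVec_mulVec,
    transpose_mul, transpose_transpose, hPt, Matrix.mul_assoc, Matrix.add_mul, add_mulVec,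
    dotProduct_add]
  ring

end OneStep

end OutputFeedback

/-! ### Past σ-algebras, second-order calculus and the noise model. -/

namespace OutputFeedback

/-- The σ-algebra generated by `x₀`, `w(0), …, w(a-1)` and `v(0), …, v(b-1)`. -/
@[reducible]
def pastSigma {Ω : Type*} {n : ℕ} (x₀ : Ω → Fin n → ℝ) (w v : ℕ → Ω → Fin n → ℝ) (a b : ℕ) :
    MeasurableSpace Ω :=
  ⨆ i ∈ {i : Unit ⊕ ℕ ⊕ ℕ | Sum.elim (fun _ => True) (Sum.elim (· < a) (· < b)) i},
    MeasurableSpace.comap (Sum.elim (fun _ : Unit => x₀) (Sum.elim w v) i) inferInstance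

theorem pastSigma_mono {Ω : Type*} {n : ℕ} {x₀ : Ω → Fin n → ℝ} {w v : ℕ → Ω → Fin n → ℝ}
    {a b a' b' : ℕ} (ha : a ≤ a') (hb : b ≤ b') : pastSigma x₀ w v a b ≤ pastSigma x₀ w v a' b' := by
  refine biSup_mono ?_
  rintro (i | i | i) hi
  · trivial
  · exact lt_of_lt_of_le (show i < a from hi) ha
  · exact lt_of_lt_of_le (show i < b from hi) hb

theorem measurable_pastSigma {Ω : Type*} {n : ℕ} (x₀ : Ω → Fin n → ℝ) (w v : ℕ → Ω → Fin n → ℝ)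
    {a b : ℕ} (i : Unit ⊕ ℕ ⊕ ℕ) (hi : Sum.elim (fun _ => True) (Sum.elim (· < a) (· < b)) i) :
    Measurable[pastSigma x₀ w v a b] (Sum.elim (fun _ : Unit => x₀) (Sum.elim w v) i) :=
  measurable_iff_comap_le.2
    (le_biSup (fun i => MeasurableSpace.comap (Sum.elim (fun _ : Unit => x₀) (Sum.elim w v) i)
      inferInstance) hi)

variable {n m M : ℕ} {Ω : Type*} [MeasurableSpace Ω] {P : Measure Ω}

section SecondOrder

theorem memLp_mulVec {k l : ℕ} (N : Matrix (Fin k) (Fin l) ℝ) {X : Ω → Fin l → ℝ}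
    (hX : MemLp X 2 P) : MemLp (fun ω => N *ᵥ X ω) 2 P := by
  refine MemLp.of_eval fun i => ?_
  simp only [mulVec, dotProduct]
  exact memLp_finsetSum _ fun j _ => (hX.eval j).const_mul (N i j)

theorem integrable_dotProduct {k : ℕ} {X Y : Ω → Fin k → ℝ} (hX : MemLp X 2 P)
    (hY : MemLp Y 2 P) : Integrable (fun ω => X ω ⬝ᵥ Y ω) P := by
  simp only [dotProduct]
  exact integrable_finsetSum _ fun j _ => (hX.eval j).integrable_mul (hY.eval j)

/-- `f` is integrable with expectation `a`. -/
def HasExpectation (P : Measure Ω) (f : Ω → ℝ) (a : ℝ) : Prop :=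
  Integrable f P ∧ ∫ ω, f ω ∂P = a

namespace HasExpectation

variable {f g : Ω → ℝ} {a b : ℝ}

theorem add (hf : HasExpectation P f a) (hg : HasExpectation P g b) :
    HasExpectation P (fun ω => f ω + g ω) (a + b) :=
  ⟨hf.1.add hg.1, by rw [integral_add hf.1 hg.1, hf.2, hg.2]⟩

theorem sub (hf : HasExpectation P f a) (hg : HasExpectation P g b) :
    HasExpectation P (fun ω => f ω - g ω) (a - b) :=
  ⟨hf.1.sub hg.1, by rw [integral_sub hf.1 hg.1, hf.2, hg.2]⟩

theorem const_mul (c : ℝ) (hf : HasExpectation P f a) :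
    HasExpectation P (fun ω => c * f ω) (c * a) :=
  ⟨hf.1.const_mul c, by rw [integral_const_mul, hf.2]⟩

theorem const [IsProbabilityMeasure P] (c : ℝ) : HasExpectation P (fun _ => c) c :=
  ⟨integrable_const c, by simp⟩

theorem sum {ι : Type*} {s : Finset ι} {f : ι → Ω → ℝ} {a : ι → ℝ}
    (h : ∀ i ∈ s, HasExpectation P (f i) (a i)) :
    HasExpectation P (fun ω => ∑ i ∈ s, f i ω) (∑ i ∈ s, a i) :=
  ⟨integrable_finsetSum _ fun i hi => (h i hi).1, by
    rw [integral_finsetSum _ fun i hi => (h i hi).1]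
    exact Finset.sum_congr rfl fun i hi => (h i hi).2⟩

end HasExpectation

theorem hasExpectation_dotProduct {k : ℕ} [IsProbabilityMeasure P] {X Y : Ω → Fin k → ℝ}
    (hX : MemLp X 2 P) (hY : MemLp Y 2 P) (h : IndepFun X Y P) :
    HasExpectation P (fun ω => X ω ⬝ᵥ Y ω) ((∫ ω, X ω ∂P) ⬝ᵥ ∫ ω, Y ω ∂P) := by
  have : (∫ ω, X ω ∂P) ⬝ᵥ ∫ ω, Y ω ∂P = ∑ i, (∫ ω, X ω i ∂P) * ∫ ω, Y ω i ∂P := by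
    simp only [dotProduct]
    refine Finset.sum_congr rfl fun i _ => ?_
    rw [eval_integral fun i => (hX.eval i).integrable one_le_two,
      eval_integral fun i => (hY.eval i).integrable one_le_two]
  rw [this]
  simp only [dotProduct]
  refine HasExpectation.sum fun i _ => ⟨(hX.eval i).integrable_mul (hY.eval i), ?_⟩
  have hi : IndepFun (fun ω => X ω i) (fun ω => Y ω i) P :=
    h.comp (measurable_pi_apply i) (measurable_pi_apply i)
  exact hi.integral_fun_mul_eq_mul_integral (hX.eval i).aestronglyMeasurable
    (hY.eval i).aestronglyMeasurable

theorem integral_mulVec {k l : ℕ} [IsFiniteMeasure P] (N : Matrix (Fin k) (Fin l) ℝ)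
    {Y : Ω → Fin l → ℝ} (hY : MemLp Y 2 P) : ∫ ω, N *ᵥ Y ω ∂P = N *ᵥ ∫ ω, Y ω ∂P := by
  ext i
  rw [eval_integral fun i => ((memLp_mulVec N hY).eval i).integrable one_le_two]
  simp only [mulVec, dotProduct]
  rw [integral_finsetSum _ fun j _ => ((hY.eval j).integrable one_le_two).const_mul _]
  refine Finset.sum_congr rfl fun j _ => ?_
  rw [integral_const_mul, eval_integral fun i => (hY.eval i).integrable one_le_two]

theorem measurable_mulVec {k l : ℕ} (N : Matrix (Fin k) (Fin l) ℝ) :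
    Measurable fun z : Fin l → ℝ => N *ᵥ z :=
  Continuous.measurable (by fun_prop)

theorem hasExpectation_bilinear {k l : ℕ} [IsProbabilityMeasure P] (N : Matrix (Fin k) (Fin l) ℝ)
    {X : Ω → Fin k → ℝ} {Y : Ω → Fin l → ℝ} (hX : MemLp X 2 P) (hY : MemLp Y 2 P)
    (h : IndepFun X Y P) :
    HasExpectation P (fun ω => X ω ⬝ᵥ (N *ᵥ Y ω)) ((∫ ω, X ω ∂P) ⬝ᵥ (N *ᵥ ∫ ω, Y ω ∂P)) := by
  rw [← integral_mulVec N hY]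
  exact hasExpectation_dotProduct hX (memLp_mulVec N hY) (h.comp measurable_id (measurable_mulVec N))

theorem hasExpectation_bilinear_zero {k l : ℕ} [IsProbabilityMeasure P]
    (N : Matrix (Fin k) (Fin l) ℝ) {X : Ω → Fin k → ℝ} {Y : Ω → Fin l → ℝ} (hX : MemLp X 2 P)
    (hY : MemLp Y 2 P) (h : IndepFun X Y P) (h0 : ∫ ω, Y ω ∂P = 0) :
    HasExpectation P (fun ω => X ω ⬝ᵥ (N *ᵥ Y ω)) 0 := by
  simpa [h0] using hasExpectation_bilinear N hX hY h

theorem hasExpectation_const_dotProduct {k : ℕ} [IsProbabilityMeasure P] (z : Fin k → ℝ)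
    {Y : Ω → Fin k → ℝ} (hY : MemLp Y 2 P) :
    HasExpectation P (fun ω => z ⬝ᵥ Y ω) (z ⬝ᵥ ∫ ω, Y ω ∂P) := by
  simpa using hasExpectation_dotProduct (memLp_const z) hY (indepFun_const_left z Y)

theorem hasExpectation_quadratic {k : ℕ} (N : Matrix (Fin k) (Fin k) ℝ) {Y : Ω → Fin k → ℝ}
    (hY : MemLp Y 2 P) :
    HasExpectation P (fun ω => Y ω ⬝ᵥ (N *ᵥ Y ω)) (N * momentMatrix P Y).trace := by
  have h : HasExpectation P (fun ω => ∑ i, ∑ j, N i j * (Y ω j * Y ω i))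
      (∑ i, ∑ j, N i j * ∫ ω, Y ω j * Y ω i ∂P) :=
    HasExpectation.sum fun i _ => HasExpectation.sum fun j _ =>
      HasExpectation.const_mul _ ⟨(hY.eval j).integrable_mul (hY.eval i), rfl⟩
  have e1 : (fun ω => Y ω ⬝ᵥ (N *ᵥ Y ω)) = fun ω => ∑ i, ∑ j, N i j * (Y ω j * Y ω i) := by
    funext ω
    simp only [dotProduct, mulVec, Finset.mul_sum]
    exact Finset.sum_congr rfl fun i _ => Finset.sum_congr rfl fun j _ => by ring
  rw [e1]
  simpa [Matrix.trace, Matrix.mul_apply, momentMatrix] using h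

theorem momentMatrix_mulVec {k : ℕ} (N : Matrix (Fin k) (Fin k) ℝ) {Y : Ω → Fin k → ℝ}
    (hY : MemLp Y 2 P) :
    momentMatrix P (fun ω => N *ᵥ Y ω) = N * momentMatrix P Y * Nᵀ := by
  ext i j
  have h : HasExpectation P (fun ω => ∑ b, ∑ a, N i a * N j b * (Y ω a * Y ω b))
      (∑ b, ∑ a, N i a * N j b * ∫ ω, Y ω a * Y ω b ∂P) :=
    HasExpectation.sum fun a _ => HasExpectation.sum fun b _ =>
      HasExpectation.const_mul _ ⟨(hY.eval b).integrable_mul (hY.eval a), rfl⟩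
  simp only [momentMatrix, of_apply, Matrix.mul_apply, mulVec, dotProduct,
    transpose_apply, Finset.sum_mul]
  rw [Finset.sum_congr rfl fun b _ => Finset.sum_congr rfl fun a _ =>
    (by ring : N i a * (∫ ω, Y ω a * Y ω b ∂P) * N j b = N i a * N j b * ∫ ω, Y ω a * Y ω b ∂P),
    ← h.2]
  refine integral_congr_ae (ae_of_all _ fun ω => ?_)
  simp only
  simp only [Finset.mul_sum]
  rw [Finset.sum_comm]
  exact Finset.sum_congr rfl fun i _ => Finset.sum_congr rfl fun j _ => by ring

end SecondOrder

/-- The standing assumptions on the initial state and the noises. -/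
structure NoiseModel (P : Measure Ω) (D : Model n m M) (p : Fin M → ℝ) (x₀ : Ω → Fin n → ℝ)
    (w v : ℕ → Ω → Fin n → ℝ) (v_b : ℝ) : Prop where
  simplex : p ∈ stdSimplex ℝ (Fin M)
  init_meas : Measurable x₀
  init_memLp : MemLp x₀ 2 P
  w_meas : ∀ t, Measurable (w t)
  w_law : ∀ t, P.map (w t) = ∑ i, ENNReal.ofReal (p i) • Measure.dirac (D.atom i)
  v_meas : ∀ t, Measurable (v t)
  v_ident : ∀ t, IdentDistrib (v t) (v 0) P P
  v_bdd : ∀ t, ∀ᵐ ω ∂P, vecNorm (v t ω) ≤ v_b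
  v_mean : ∫ ω, v 0 ω ∂P = 0
  indep : iIndepFun (Sum.elim (fun _ : Unit => x₀) (Sum.elim w v)) P

namespace NoiseModel

variable {D : Model n m M} {p : Fin M → ℝ} {x₀ : Ω → Fin n → ℝ} {w v : ℕ → Ω → Fin n → ℝ}
  {v_b : ℝ}

theorem ae_mem_atoms (h : NoiseModel P D p x₀ w v v_b) (t : ℕ) :
    ∀ᵐ ω ∂P, ∃ i, w t ω = D.atom i := by
  have hs : MeasurableSet {z : Fin n → ℝ | ∃ i, z = D.atom i} := by
    have : {z : Fin n → ℝ | ∃ i, z = D.atom i} = Set.range D.atom := by ext; simp [eq_comm]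
    rw [this]; exact (Set.finite_range _).measurableSet
  rw [← ae_map_iff (p := fun z => ∃ i, z = D.atom i) (h.w_meas t).aemeasurable hs, h.w_law t,
    ae_iff, Measure.finsetSum_apply]
  refine Finset.sum_eq_zero fun i _ => ?_
  have h0 : Measure.dirac (D.atom i) {z : Fin n → ℝ | ¬ ∃ i, z = D.atom i} = 0 := by
    rw [show {z : Fin n → ℝ | ¬ ∃ i, z = D.atom i} = {z : Fin n → ℝ | ∃ i, z = D.atom i}ᶜ from rfl,
      Measure.dirac_apply' _ hs.compl]
    simp
  rw [Measure.smul_apply, h0, smul_zero]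

theorem hasExpectation_comp_w (h : NoiseModel P D p x₀ w v v_b) (t : ℕ) {f : (Fin n → ℝ) → ℝ}
    (hf : Measurable f) : HasExpectation P (fun ω => f (w t ω)) (∑ i, p i * f (D.atom i)) := by
  have hi : ∀ i ∈ Finset.univ, Integrable f
      (ENNReal.ofReal (p i) • Measure.dirac (D.atom i)) := fun i _ =>
    (integrable_dirac (by simp)).smul_measure (by simp)
  have hI : Integrable f (P.map (w t)) := by
    rw [h.w_law t]; exact integrable_finsetSum_measure.2 hi
  refine ⟨(integrable_map_measure hf.aestronglyMeasurable (h.w_meas t).aemeasurable).1 hI, ?_⟩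
  rw [← integral_map (h.w_meas t).aemeasurable hf.aestronglyMeasurable, h.w_law t,
    integral_finsetSum_measure hi]
  refine Finset.sum_congr rfl fun i _ => ?_
  rw [integral_smul_measure, integral_dirac, ENNReal.toReal_ofReal (h.simplex.1 i), smul_eq_mul]

theorem w_memLp [IsFiniteMeasure P] (h : NoiseModel P D p x₀ w v v_b) (t : ℕ) : MemLp (w t) 2 P := by
  refine MemLp.of_bound (h.w_meas t).aestronglyMeasurable (∑ i, ‖D.atom i‖) ?_
  filter_upwards [h.ae_mem_atoms t] with ω ⟨i, hi⟩
  rw [hi]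
  exact Finset.single_le_sum (f := fun i => ‖D.atom i‖) (fun _ _ => norm_nonneg _)
    (Finset.mem_univ i)

/-- The bound `v_b` is Euclidean, while `MemLp` uses the sup norm of the function type. -/
theorem norm_le_vecNorm (z : Fin n → ℝ) : ‖z‖ ≤ vecNorm z := by
  refine (pi_norm_le_iff_of_nonneg (norm_nonneg _)).2 fun i => ?_
  exact PiLp.norm_apply_le (WithLp.toLp 2 z) i

theorem v_memLp [IsFiniteMeasure P] (h : NoiseModel P D p x₀ w v v_b) (t : ℕ) : MemLp (v t) 2 P := by
  refine MemLp.of_bound (h.v_meas t).aestronglyMeasurable v_b ?_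
  filter_upwards [h.v_bdd t] with ω hω using (norm_le_vecNorm _).trans hω

theorem integral_w [IsFiniteMeasure P] (h : NoiseModel P D p x₀ w v v_b) (t : ℕ) :
    ∫ ω, w t ω ∂P = meanOf D.atom p := by
  ext i
  rw [eval_integral fun i => ((h.w_memLp t).eval i).integrable one_le_two,
    (h.hasExpectation_comp_w t (measurable_pi_apply i)).2]
  simp [meanOf]

theorem momentMatrix_w (h : NoiseModel P D p x₀ w v v_b) (t : ℕ) :
    momentMatrix P (w t) = secondMoment D.atom p := by
  ext i j
  have h2 := (h.hasExpectation_comp_w t ((measurable_pi_apply i).mul (measurable_pi_apply j))).2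
  simp only [Pi.mul_apply] at h2
  simp only [momentMatrix, of_apply]
  rw [h2]
  simp [secondMoment, Matrix.sum_apply, vecMulVec_apply]

theorem integral_v (h : NoiseModel P D p x₀ w v v_b) (t : ℕ) : ∫ ω, v t ω ∂P = 0 := by
  rw [(h.v_ident t).integral_eq, h.v_mean]

theorem momentMatrix_v (h : NoiseModel P D p x₀ w v v_b) (t : ℕ) :
    momentMatrix P (v t) = momentMatrix P (v 0) := by
  ext i j
  simp only [momentMatrix, of_apply]
  exact ((h.v_ident t).comp ((measurable_pi_apply i).mul (measurable_pi_apply j))).integral_eq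

end NoiseModel

section Past

variable {D : Model n m M} {p : Fin M → ℝ} {x₀ : Ω → Fin n → ℝ} {w v : ℕ → Ω → Fin n → ℝ}
  {v_b : ℝ}

/-- Disjoint blocks of an independent family generate independent σ-algebras, and `i` lies outside
the block of the past. -/
theorem NoiseModel.indepFun_past (h : NoiseModel P D p x₀ w v v_b) {a b : ℕ} {k : ℕ}
    {X : Ω → Fin k → ℝ} (hX : Measurable[pastSigma x₀ w v a b] X) (i : Unit ⊕ ℕ ⊕ ℕ)
    (hi : ¬ Sum.elim (fun _ => True) (Sum.elim (· < a) (· < b)) i) :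
    IndepFun X (Sum.elim (fun _ : Unit => x₀) (Sum.elim w v) i) P := by
  rw [IndepFun_iff_Indep]
  have hle : ∀ j, MeasurableSpace.comap (Sum.elim (fun _ : Unit => x₀) (Sum.elim w v) j)
      inferInstance ≤ ‹MeasurableSpace Ω› := by
    rintro (i | i | i)
    · exact h.init_meas.comap_le
    · exact (h.w_meas i).comap_le
    · exact (h.v_meas i).comap_le
  have hI := indep_iSup_of_disjoint hle h.indep.iIndep
    (S := {i | Sum.elim (fun _ => True) (Sum.elim (· < a) (· < b)) i}) (T := {i})
    (Set.disjoint_singleton_right.2 hi)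
  refine indep_of_indep_of_le_right (indep_of_indep_of_le_left hI hX.comap_le) ?_
  simp

/-- The number `b` of known measurement noises is free: `u(t)` involves `v(t)` and must still be
independent of `w(t)`. -/
theorem NoiseModel.indepFun_w (h : NoiseModel P D p x₀ w v v_b) {t b : ℕ} {k : ℕ}
    {X : Ω → Fin k → ℝ} (hX : Measurable[pastSigma x₀ w v t b] X) : IndepFun X (w t) P :=
  h.indepFun_past hX (Sum.inr (Sum.inl t)) (by simp)

theorem NoiseModel.indepFun_v (h : NoiseModel P D p x₀ w v v_b) {a t : ℕ} {k : ℕ}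
    {X : Ω → Fin k → ℝ} (hX : Measurable[pastSigma x₀ w v a t] X) : IndepFun X (v t) P :=
  h.indepFun_past hX (Sum.inr (Sum.inr t)) (by simp)

end Past

end OutputFeedback

/-! ### The closed loop with an arbitrary mean estimate, and its cost. -/

namespace OutputFeedback

variable {n m M : ℕ} {Ω : Type*}

section Loop

variable (D : Model n m M) (T : ℕ) (x₀ : Ω → Fin n → ℝ) (w v ν : ℕ → Ω → Fin n → ℝ)

/-- The state of the closed loop in which the feedback law uses `ν t` in place of the mean of the
system noise. -/
noncomputable def loopState : ℕ → Ω → Fin n → ℝ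
  | 0 => x₀
  | t + 1 => fun ω => D.A *ᵥ loopState t ω
      + D.B *ᵥ feedback D T t (loopState t ω + D.C⁻¹ *ᵥ v t ω) (ν t ω) + w t ω

/-- The input belonging to `loopState`. -/
noncomputable def loopInput (t : ℕ) (ω : Ω) : Fin m → ℝ :=
  feedback D T t (loopState D T x₀ w v ν t ω + D.C⁻¹ *ᵥ v t ω) (ν t ω)

theorem loopState_succ (t : ℕ) (ω : Ω) : loopState D T x₀ w v ν (t + 1) ω
    = D.A *ᵥ loopState D T x₀ w v ν t ω + D.B *ᵥ loopInput D T x₀ w v ν t ω + w t ω := rfl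

/-- The quadratic value function evaluated at the state estimate. -/
noncomputable def valueAt (μ : Fin n → ℝ) (t : ℕ) (ω : Ω) : ℝ :=
  (loopState D T x₀ w v ν t ω + D.C⁻¹ *ᵥ v t ω) ⬝ᵥ
      (riccati D T t *ᵥ (loopState D T x₀ w v ν t ω + D.C⁻¹ *ᵥ v t ω))
    + 2 * ((loopState D T x₀ w v ν t ω + D.C⁻¹ *ᵥ v t ω) ⬝ᵥ (adjointL D T t *ᵥ μ))

variable {D T x₀ w v ν}

theorem measurable_feedback (t : ℕ) :
    Measurable fun z : (Fin n → ℝ) × (Fin n → ℝ) => feedback D T t z.1 z.2 :=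
  Continuous.measurable (by unfold feedback; fun_prop)

theorem measurable_affine_comp {m' : MeasurableSpace Ω} {k l : ℕ} (N : Matrix (Fin n) (Fin k) ℝ)
    (N' : Matrix (Fin n) (Fin l) ℝ) {X : Ω → Fin k → ℝ} {U : Ω → Fin l → ℝ} {W : Ω → Fin n → ℝ}
    (hX : Measurable X) (hU : Measurable U) (hW : Measurable W) :
    Measurable fun ω => N *ᵥ X ω + N' *ᵥ U ω + W ω :=
  (((measurable_mulVec N).comp hX).add ((measurable_mulVec N').comp hU)).add hW

theorem measurable_feedback_comp {m' : MeasurableSpace Ω} (t : ℕ) {X V Y : Ω → Fin n → ℝ}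
    (hX : Measurable X) (hV : Measurable V) (hY : Measurable Y) :
    Measurable fun ω => feedback D T t (X ω + D.C⁻¹ *ᵥ V ω) (Y ω) := by
  have hξ : Measurable fun ω => X ω + D.C⁻¹ *ᵥ V ω := hX.add ((measurable_mulVec D.C⁻¹).comp hV)
  have hc : Measurable fun ω => (X ω + D.C⁻¹ *ᵥ V ω, Y ω) := hξ.prodMk hY
  have hf := (measurable_feedback (D := D) (T := T) t).comp hc
  simpa only [Function.comp_def] using hf

/-- The indices `t` and `t + 1` record that the input uses `v(t)` but not `w(t)`, whereas the state
at time `t` uses neither. -/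
theorem measurable_loopInput (hν : ∀ t, Measurable[pastSigma x₀ w v t t] (ν t)) (t : ℕ)
    (hX : Measurable[pastSigma x₀ w v t t] (loopState D T x₀ w v ν t)) :
    Measurable[pastSigma x₀ w v t (t + 1)] (loopInput D T x₀ w v ν t) := by
  have hle : pastSigma x₀ w v t t ≤ pastSigma x₀ w v t (t + 1) :=
    pastSigma_mono le_rfl (Nat.le_succ t)
  have hv : Measurable[pastSigma x₀ w v t (t + 1)] (v t) :=
    measurable_pastSigma x₀ w v (Sum.inr (Sum.inr t)) (Nat.lt_succ_self t)
  exact measurable_feedback_comp t (hX.mono hle le_rfl) hv ((hν t).mono hle le_rfl)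

theorem measurable_loopState (hν : ∀ t, Measurable[pastSigma x₀ w v t t] (ν t)) (t : ℕ) :
    Measurable[pastSigma x₀ w v t t] (loopState D T x₀ w v ν t) := by
  induction t with
  | zero => exact measurable_pastSigma x₀ w v (Sum.inl ()) trivial
  | succ t ih =>
    have hw : Measurable[pastSigma x₀ w v (t + 1) (t + 1)] (w t) :=
      measurable_pastSigma x₀ w v (Sum.inr (Sum.inl t)) (Nat.lt_succ_self t)
    have l1 : pastSigma x₀ w v t t ≤ pastSigma x₀ w v (t + 1) (t + 1) :=
      pastSigma_mono (Nat.le_succ t) (Nat.le_succ t)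
    have l2 : pastSigma x₀ w v t (t + 1) ≤ pastSigma x₀ w v (t + 1) (t + 1) :=
      pastSigma_mono (Nat.le_succ t) le_rfl
    exact measurable_affine_comp D.A D.B (ih.mono l1 le_rfl)
      ((measurable_loopInput hν t ih).mono l2 le_rfl) hw

end Loop

section Cost

variable [MeasurableSpace Ω] {P : Measure Ω} {D : Model n m M}
  {p : Fin M → ℝ} {x₀ : Ω → Fin n → ℝ} {w v ν : ℕ → Ω → Fin n → ℝ} {v_b : ℝ}

theorem integrable_quadratic {k : ℕ} (N : Matrix (Fin k) (Fin k) ℝ) {Y : Ω → Fin k → ℝ}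
    (hY : MemLp Y 2 P) : Integrable (fun ω => Y ω ⬝ᵥ (N *ᵥ Y ω)) P :=
  integrable_dotProduct hY (memLp_mulVec N hY)

variable [IsProbabilityMeasure P]

theorem memLp_loop (h : NoiseModel P D p x₀ w v v_b) (hν : ∀ t, MemLp (ν t) 2 P) (T t : ℕ) :
    MemLp (loopState D T x₀ w v ν t) 2 P ∧ MemLp (loopInput D T x₀ w v ν t) 2 P := by
  have hinp : ∀ t, MemLp (loopState D T x₀ w v ν t) 2 P →
      MemLp (loopInput D T x₀ w v ν t) 2 P := fun t ht => by
    have hξ := ht.add (memLp_mulVec D.C⁻¹ (h.v_memLp t))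
    exact (memLp_mulVec (upsilon D T t)⁻¹ (((memLp_mulVec _ hξ).add (memLp_mulVec _ (hν t))).add
      (memLp_mulVec _ (hν t)))).neg
  suffices hs : MemLp (loopState D T x₀ w v ν t) 2 P from ⟨hs, hinp t hs⟩
  induction t with
  | zero => exact h.init_memLp
  | succ t ih =>
    exact ((memLp_mulVec D.A ih).add (memLp_mulVec D.B (hinp t ih))).add (h.w_memLp t)

theorem integrable_valueAt (h : NoiseModel P D p x₀ w v v_b) (hν : ∀ t, MemLp (ν t) 2 P)
    (T t : ℕ) (μ : Fin n → ℝ) : Integrable (valueAt D T x₀ w v ν μ t) P := by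
  have hξ := (memLp_loop h hν T t).1.add (memLp_mulVec D.C⁻¹ (h.v_memLp t))
  exact (integrable_quadratic _ hξ).add ((integrable_dotProduct hξ (memLp_const _)).const_mul 2)

/-- One step of dynamic programming for the closed loop. -/
theorem stage_value_step (hQ : ∀ t, (D.Q t).PosSemidef) (hR : ∀ t, (D.R t).PosDef)
    (hPterm : ∀ T, (D.Pterm T).PosSemidef) (h : NoiseModel P D p x₀ w v v_b)
    (hνm : ∀ t, Measurable[pastSigma x₀ w v t t] (ν t)) (hν : ∀ t, MemLp (ν t) 2 P)
    {T t : ℕ} (ht : t ≤ T) :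
    (∫ ω, (loopState D T x₀ w v ν t ω ⬝ᵥ (D.Q t *ᵥ loopState D T x₀ w v ν t ω)
        + loopInput D T x₀ w v ν t ω ⬝ᵥ (D.R t *ᵥ loopInput D T x₀ w v ν t ω)) ∂P)
      + ∫ ω, valueAt D T x₀ w v ν (meanOf D.atom p) (t + 1) ω ∂P
    = (∫ ω, valueAt D T x₀ w v ν (meanOf D.atom p) t ω ∂P)
      + (∫ ω, (meanOf D.atom p - ν t ω) ⬝ᵥ (dMat D T t *ᵥ (meanOf D.atom p - ν t ω)) ∂P)
      + (-(meanOf D.atom p ⬝ᵥ (dMat D T t *ᵥ meanOf D.atom p))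
        + 2 * (meanOf D.atom p ⬝ᵥ (adjointL D T (t + 1) *ᵥ meanOf D.atom p))
        + (D.Aᵀ * riccati D T (t + 1) * D.B * (upsilon D T t)⁻¹ * D.Bᵀ * riccati D T (t + 1) * D.A
            * (D.C⁻¹ * momentMatrix P (v 0) * (D.C⁻¹)ᵀ)).trace
        + (riccati D T (t + 1) * secondMoment D.atom p).trace)
      + (riccati D T (t + 1) * (D.C⁻¹ * momentMatrix P (v 0) * (D.C⁻¹)ᵀ)).trace
      - (riccati D T t * (D.C⁻¹ * momentMatrix P (v 0) * (D.C⁻¹)ᵀ)).trace := by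
  set μ := meanOf D.atom p with hμ
  set X := loopState D T x₀ w v ν with hX
  set U := loopInput D T x₀ w v ν with hU
  set S := riccati D T (t + 1) with hS
  set L := adjointL D T (t + 1) with hL
  set Qb := D.C⁻¹ * momentMatrix P (v 0) * (D.C⁻¹)ᵀ with hQb
  have hSp : S.PosSemidef := riccati_posSemidef hQ hR hPterm T (t + 1)
  have lX := (memLp_loop h hν T t).1
  have lU := (memLp_loop h hν T t).2
  have lX' := (memLp_loop h hν T (t + 1)).1
  have mX := measurable_loopState (D := D) (T := T) hνm t
  have mU := measurable_loopInput hνm t mX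
  have mX' := measurable_loopState (D := D) (T := T) hνm (t + 1)
  rw [← hX] at lX lX' mX mX'
  rw [← hU] at lU mU
  have lv : ∀ s, MemLp (fun ω => D.C⁻¹ *ᵥ v s ω) 2 P := fun s => memLp_mulVec _ (h.v_memLp s)
  have mv : ∀ s, ∫ ω, D.C⁻¹ *ᵥ v s ω ∂P = 0 := fun s => by
    rw [integral_mulVec _ (h.v_memLp s), h.integral_v, mulVec_zero]
  have qv : ∀ s, momentMatrix P (fun ω => D.C⁻¹ *ᵥ v s ω) = Qb := fun s => by
    rw [momentMatrix_mulVec _ (h.v_memLp s), h.momentMatrix_v]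
  have iv : ∀ {s a : ℕ} {Y : Ω → Fin n → ℝ}, Measurable[pastSigma x₀ w v a s] Y →
      IndepFun Y (fun ω => D.C⁻¹ *ᵥ v s ω) P := fun hY =>
    (h.indepFun_v hY).comp measurable_id (measurable_mulVec _)
  set K := D.Aᵀ * S * D.B * (D.R t + D.Bᵀ * S * D.B)⁻¹ * D.Bᵀ * S * D.A with hK
  have hfb : ∀ ω, U t ω = -((D.R t + D.Bᵀ * S * D.B)⁻¹ *ᵥ
      ((D.Bᵀ * S * D.A) *ᵥ (X t ω + D.C⁻¹ *ᵥ v t ω) + (D.Bᵀ * S) *ᵥ ν t ω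
        + (D.Bᵀ * L) *ᵥ ν t ω)) := fun ω => rfl
  -- A pointwise identity combining the three algebraic lemmas. From `X t ω ⬝ᵥ (K *ᵥ …)` on, the
  -- expectations vanish, the two terms in `w t ω` and `μ` only as a difference.
  have hpt : ∀ ω, (X t ω ⬝ᵥ (D.Q t *ᵥ X t ω) + U t ω ⬝ᵥ (D.R t *ᵥ U t ω))
        + valueAt D T x₀ w v ν μ (t + 1) ω
      = valueAt D T x₀ w v ν μ t ω + (μ - ν t ω) ⬝ᵥ (dMat D T t *ᵥ (μ - ν t ω))
        - μ ⬝ᵥ (dMat D T t *ᵥ μ)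
        + w t ω ⬝ᵥ (S *ᵥ w t ω) + (D.C⁻¹ *ᵥ v (t + 1) ω) ⬝ᵥ (S *ᵥ (D.C⁻¹ *ᵥ v (t + 1) ω))
        + 2 * ((L *ᵥ μ) ⬝ᵥ w t ω)
        - (D.C⁻¹ *ᵥ v t ω) ⬝ᵥ ((D.Aᵀ * S * D.A + D.Q t) *ᵥ (D.C⁻¹ *ᵥ v t ω))
        + 2 * ((D.C⁻¹ *ᵥ v t ω) ⬝ᵥ (K *ᵥ (D.C⁻¹ *ᵥ v t ω)))
        + 2 * (X t ω ⬝ᵥ (K *ᵥ (D.C⁻¹ *ᵥ v t ω)))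
        + 2 * (ν t ω ⬝ᵥ (((S + Lᵀ) * D.B * (D.R t + D.Bᵀ * S * D.B)⁻¹ * D.Bᵀ * S * D.A) *ᵥ
            (D.C⁻¹ *ᵥ v t ω)))
        + (2 * (D.A *ᵥ X t ω + D.B *ᵥ U t ω) ⬝ᵥ (S *ᵥ w t ω)
          - 2 * (D.A *ᵥ X t ω + D.B *ᵥ U t ω) ⬝ᵥ (S *ᵥ μ))
        + 2 * (X (t + 1) ω ⬝ᵥ (S *ᵥ (D.C⁻¹ *ᵥ v (t + 1) ω)))
        + 2 * ((L *ᵥ μ) ⬝ᵥ (D.C⁻¹ *ᵥ v (t + 1) ω))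
        - 2 * (X t ω ⬝ᵥ ((D.Aᵀ * S * D.A + D.Q t) *ᵥ (D.C⁻¹ *ᵥ v t ω)))
        - 2 * (((D.Aᵀ * (S + L)) *ᵥ μ) ⬝ᵥ (D.C⁻¹ *ᵥ v t ω)) := by
    intro ω
    have e1 := stage_expansion (A := D.A) (B := D.B) (L := L) (R := D.R t)
      (posSemidef_transpose_eq hSp) (posSemidef_transpose_eq (hQ t)) (X t ω) (D.C⁻¹ *ᵥ v t ω)
      (w t ω) (D.C⁻¹ *ᵥ v (t + 1) ω) μ (U t ω)
    have e2 := stage_completion (Q := D.Q t) hSp (hR t) (X t ω + D.C⁻¹ *ᵥ v t ω) μ (ν t ω)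
      (U t ω) (hfb ω)
    have e3 := feedback_error_cross hSp (hR t) (X t ω) (D.C⁻¹ *ᵥ v t ω) (ν t ω) (U t ω) (hfb ω)
    have e4 : X (t + 1) ω = D.A *ᵥ X t ω + D.B *ᵥ U t ω + w t ω := rfl
    rw [← hK] at e3
    have e5 : valueAt D T x₀ w v ν μ (t + 1) ω
        = (D.A *ᵥ X t ω + D.B *ᵥ U t ω + w t ω + D.C⁻¹ *ᵥ v (t + 1) ω) ⬝ᵥ
            (S *ᵥ (D.A *ᵥ X t ω + D.B *ᵥ U t ω + w t ω + D.C⁻¹ *ᵥ v (t + 1) ω))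
          + 2 * ((D.A *ᵥ X t ω + D.B *ᵥ U t ω + w t ω + D.C⁻¹ *ᵥ v (t + 1) ω) ⬝ᵥ (L *ᵥ μ)) := rfl
    have e6 : valueAt D T x₀ w v ν μ t ω
        = (X t ω + D.C⁻¹ *ᵥ v t ω) ⬝ᵥ (riccatiMap D.A D.B (D.Q t) (D.R t) S *ᵥ
            (X t ω + D.C⁻¹ *ᵥ v t ω))
          + 2 * ((X t ω + D.C⁻¹ *ᵥ v t ω) ⬝ᵥ
            (((D.Aᵀ - D.Aᵀ * S * D.B * (D.R t + D.Bᵀ * S * D.B)⁻¹ * D.Bᵀ) * (S + L)) *ᵥ μ)) := by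
      rw [valueAt, riccati_of_le D ht, adjointL_of_le D ht]; rfl
    have e7 : dMat D T t
        = (S + L)ᵀ * D.B * (D.R t + D.Bᵀ * S * D.B)⁻¹ * D.Bᵀ * (S + L) := rfl
    rw [e5, e6, e7, e4]
    rw [mulVec_sub, dotProduct_sub, dotProduct_comm (w t ω) (L *ᵥ μ)] at e1
    linear_combination e1 + e2 - 2 * e3
  -- `A x(t) + B u(t)` contains `v(t)` but not `w(t)`, so in expectation `w(t)` may be replaced by
  -- its mean.
  have mZ : Measurable[pastSigma x₀ w v t (t + 1)] fun ω => D.A *ᵥ X t ω + D.B *ᵥ U t ω := by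
    have l1 : pastSigma x₀ w v t t ≤ pastSigma x₀ w v t (t + 1) :=
      pastSigma_mono le_rfl (Nat.le_succ t)
    simpa using measurable_affine_comp D.A D.B (mX.mono l1 le_rfl) mU
      (measurable_const (a := (0 : Fin n → ℝ)))
  have lZ : MemLp (fun ω => D.A *ᵥ X t ω + D.B *ᵥ U t ω) 2 P :=
    (memLp_mulVec D.A lX).add (memLp_mulVec D.B lU)
  have lw := h.w_memLp t
  have iV : ∀ s, HasExpectation P (valueAt D T x₀ w v ν μ s)
      (∫ ω, valueAt D T x₀ w v ν μ s ω ∂P) := fun s => ⟨integrable_valueAt h hν T s μ, rfl⟩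
  have iD : HasExpectation P (fun ω => (μ - ν t ω) ⬝ᵥ (dMat D T t *ᵥ (μ - ν t ω)))
      (∫ ω, (μ - ν t ω) ⬝ᵥ (dMat D T t *ᵥ (μ - ν t ω)) ∂P) :=
    ⟨integrable_quadratic _ ((memLp_const μ).sub (hν t)), rfl⟩
  have iw := hasExpectation_quadratic S lw
  rw [h.momentMatrix_w] at iw
  have iv1 := hasExpectation_quadratic S (lv (t + 1))
  have iv2 := hasExpectation_quadratic (D.Aᵀ * S * D.A + D.Q t) (lv t)
  have iv3 := hasExpectation_quadratic K (lv t)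
  rw [qv] at iv1 iv2 iv3
  have iLw := hasExpectation_const_dotProduct (L *ᵥ μ) lw
  rw [h.integral_w] at iLw
  have iLv := hasExpectation_const_dotProduct (L *ᵥ μ) (lv (t + 1))
  have iAv := hasExpectation_const_dotProduct ((D.Aᵀ * (S + L)) *ᵥ μ) (lv t)
  rw [mv, dotProduct_zero] at iLv iAv
  have iZw := hasExpectation_bilinear S lZ lw (h.indepFun_w mZ)
  rw [h.integral_w] at iZw
  have iZμ := hasExpectation_bilinear S lZ (memLp_const μ) (indepFun_const_right _ _)
  rw [integral_const, probReal_univ, one_smul] at iZμ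
  have j1 := hasExpectation_bilinear_zero K lX (lv t) (iv mX) (mv t)
  have j2 := hasExpectation_bilinear_zero
    ((S + Lᵀ) * D.B * (D.R t + D.Bᵀ * S * D.B)⁻¹ * D.Bᵀ * S * D.A) (hν t) (lv t) (iv (hνm t)) (mv t)
  have j3 := hasExpectation_bilinear_zero S lX' (lv (t + 1)) (iv mX') (mv (t + 1))
  have j4 := hasExpectation_bilinear_zero (D.Aᵀ * S * D.A + D.Q t) lX (lv t) (iv mX) (mv t)
  have tot := ((((((((((((((iV t).add iD).sub (.const (μ ⬝ᵥ (dMat D T t *ᵥ μ)))).add iw).add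
    iv1).add (iLw.const_mul 2)).sub iv2).add (iv3.const_mul 2)).add (j1.const_mul 2)).add
    (j2.const_mul 2)).add ((iZw.const_mul 2).sub (iZμ.const_mul 2))).add (j3.const_mul 2)).add
    (iLv.const_mul 2)).sub (j4.const_mul 2)).sub (iAv.const_mul 2)
  have iS : Integrable (fun ω => X t ω ⬝ᵥ (D.Q t *ᵥ X t ω) + U t ω ⬝ᵥ (D.R t *ᵥ U t ω)) P :=
    (integrable_quadratic _ lX).add (integrable_quadratic _ lU)
  rw [← integral_add iS (iV (t + 1)).1, integral_congr_ae (ae_of_all _ hpt), tot.2,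
    riccati_of_le D ht, dotProduct_comm (L *ᵥ μ) μ]
  -- The error at time `t` contributes `-(A'SA + Q) + 2K` against `Q̄_v`. Since `P_T(t) = A'SA + Q -
  -- K`, this is `-P_T(t) + K`: a telescoping term and the trace of `H_T`.
  have hK' : D.Aᵀ * S * D.B * (upsilon D T t)⁻¹ * D.Bᵀ * S * D.A = K := rfl
  have hr : riccatiMap D.A D.B (D.Q t) (D.R t) (riccati D T (t + 1))
      = D.Aᵀ * S * D.A + D.Q t - K := rfl
  rw [hK', hr, Matrix.sub_mul _ K, trace_sub]
  ring

/-- The cost of the closed loop in terms of the errors `μ - ν t`. -/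
theorem loop_cost (hQ : ∀ t, (D.Q t).PosSemidef) (hR : ∀ t, (D.R t).PosDef)
    (hPterm : ∀ T, (D.Pterm T).PosSemidef) (h : NoiseModel P D p x₀ w v v_b)
    (hνm : ∀ t, Measurable[pastSigma x₀ w v t t] (ν t)) (hν : ∀ t, MemLp (ν t) 2 P) (T : ℕ) :
    (∑ t ∈ Finset.range (T + 1),
        ∫ ω, (loopState D T x₀ w v ν t ω ⬝ᵥ (D.Q t *ᵥ loopState D T x₀ w v ν t ω)
          + loopInput D T x₀ w v ν t ω ⬝ᵥ (D.R t *ᵥ loopInput D T x₀ w v ν t ω)) ∂P)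
      + ∫ ω, loopState D T x₀ w v ν (T + 1) ω ⬝ᵥ
          (D.Pterm T *ᵥ loopState D T x₀ w v ν (T + 1) ω) ∂P
    = (∫ ω, valueAt D T x₀ w v ν (meanOf D.atom p) 0 ω ∂P)
      + hConst D p (D.C⁻¹ * momentMatrix P (v 0) * (D.C⁻¹)ᵀ) T
      + ∑ t ∈ Finset.range (T + 1),
          ∫ ω, (meanOf D.atom p - ν t ω) ⬝ᵥ (dMat D T t *ᵥ (meanOf D.atom p - ν t ω)) ∂P := by
  have hsum := Finset.sum_congr rfl fun t (ht : t ∈ Finset.range (T + 1)) =>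
    stage_value_step hQ hR hPterm h hνm hν (Nat.lt_succ_iff.1 (Finset.mem_range.1 ht))
  -- The value function is taken at the estimate, so it exceeds the terminal cost by `Tr(P_{T+1}
  -- Q̄_v)`; the upper end of the telescoping traces cancels this excess, and the lower end is the
  -- last term of `H_T`.
  have hterm : ∫ ω, valueAt D T x₀ w v ν (meanOf D.atom p) (T + 1) ω ∂P
      = (∫ ω, loopState D T x₀ w v ν (T + 1) ω ⬝ᵥ
          (D.Pterm T *ᵥ loopState D T x₀ w v ν (T + 1) ω) ∂P)
        + (riccati D T (T + 1) * (D.C⁻¹ * momentMatrix P (v 0) * (D.C⁻¹)ᵀ)).trace := by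
    have lX := (memLp_loop h hν T (T + 1)).1
    have lv : MemLp (fun ω => D.C⁻¹ *ᵥ v (T + 1) ω) 2 P := memLp_mulVec _ (h.v_memLp _)
    have i1 : HasExpectation P _ _ := ⟨integrable_quadratic (D.Pterm T) lX, rfl⟩
    have i2 := hasExpectation_quadratic (D.Pterm T) lv
    have i3 := hasExpectation_bilinear_zero (D.Pterm T) lX lv
      ((h.indepFun_v (measurable_loopState hνm (T + 1))).comp measurable_id (measurable_mulVec _))
      (by rw [integral_mulVec _ (h.v_memLp _), h.integral_v, mulVec_zero])
    rw [momentMatrix_mulVec _ (h.v_memLp _), h.momentMatrix_v] at i2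
    rw [riccati_of_lt D (Nat.lt_succ_self T)]
    refine Eq.trans (integral_congr_ae (ae_of_all _ fun ω => ?_))
      (((i1.add i2).add (i3.const_mul 2)).2.trans (by ring))
    simp only [valueAt, riccati_of_lt D (Nat.lt_succ_self T),
      adjointL_of_lt D (Nat.lt_succ_self T), zero_mulVec, dotProduct_zero, mul_zero, add_zero,
      mulVec_add, dotProduct_add, add_dotProduct]
    rw [dotProduct_mulVec_swap (D.Pterm T) (D.C⁻¹ *ᵥ v (T + 1) ω) (loopState D T x₀ w v ν (T + 1) ω),
      posSemidef_transpose_eq (hPterm T)]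
    ring
  have tel := fun f : ℕ → ℝ => Finset.sum_range_sub f (T + 1)
  have t1 := tel fun t => ∫ ω, valueAt D T x₀ w v ν (meanOf D.atom p) t ω ∂P
  have t2 := tel fun t => (riccati D T t * (D.C⁻¹ * momentMatrix P (v 0) * (D.C⁻¹)ᵀ)).trace
  simp only [Finset.sum_add_distrib, Finset.sum_sub_distrib] at hsum t1 t2
  simp only [hConst, Finset.sum_add_distrib]
  linarith

end Cost

end OutputFeedback

/-! ### Exact identification of the noise and reduction of both policies to the loop. -/

namespace OutputFeedback

variable {n m M : ℕ} {Ω : Type*}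

section Norms

theorem vecNorm_mulVec_le (N : Matrix (Fin n) (Fin n) ℝ) (z : Fin n → ℝ) :
    vecNorm (N *ᵥ z) ≤ opNorm N * vecNorm z := by
  have h := (Matrix.toEuclideanCLM (n := Fin n) (𝕜 := ℝ) N).le_opNorm (WithLp.toLp 2 z)
  simpa [vecNorm, opNorm] using h

theorem vecNorm_sub_le (y z : Fin n → ℝ) : vecNorm (y - z) ≤ vecNorm y + vecNorm z := by
  simpa [vecNorm] using norm_sub_le (WithLp.toLp 2 y) (WithLp.toLp 2 z)

theorem vecNorm_sub_triangle (x y z : Fin n → ℝ) :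
    vecNorm (x - z) ≤ vecNorm (y - x) + vecNorm (y - z) := by
  have h := vecNorm_sub_le (y - z) (y - x)
  rw [sub_sub_sub_cancel_left] at h
  linarith

theorem opNorm_nonneg (N : Matrix (Fin n) (Fin n) ℝ) : 0 ≤ opNorm N := norm_nonneg _

theorem vecNorm_nonneg (z : Fin n → ℝ) : 0 ≤ vecNorm z := norm_nonneg _

end Norms

section Identification

variable {D : Model n m M} {π : Policy n m} {x₀ : Ω → Fin n → ℝ} {w v : ℕ → Ω → Fin n → ℝ}
  {v_b : ℝ}

theorem stateEst_eq (hC : IsUnit D.C.det) (π : Policy n m) (x₀ : Ω → Fin n → ℝ)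
    (w v : ℕ → Ω → Fin n → ℝ) (t : ℕ) (ω : Ω) :
    stateEst D π x₀ w v t ω = state D π x₀ w v t ω + D.C⁻¹ *ᵥ v t ω := by
  rw [stateEst, output, mulVec_add, mulVec_mulVec, nonsing_inv_mul _ hC, one_mulVec]

/-- State and input cancel, so the estimation error is the same for every policy. -/
theorem noiseEst_eq (hC : IsUnit D.C.det) (π : Policy n m) (x₀ : Ω → Fin n → ℝ)
    (w v : ℕ → Ω → Fin n → ℝ) (t : ℕ) (ω : Ω) :
    noiseEst D π x₀ w v t ω
      = w t ω + (D.C⁻¹ *ᵥ v (t + 1) ω - D.A *ᵥ (D.C⁻¹ *ᵥ v t ω)) := by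
  rw [noiseEst, stateEst_eq hC, stateEst_eq hC, state_succ, mulVec_add]
  abel

theorem vecNorm_noise_error_le (hC : IsUnit D.C.det) {t : ℕ} {ω : Ω}
    (hv : ∀ t, vecNorm (v t ω) ≤ v_b) :
    vecNorm (noiseEst D π x₀ w v t ω - w t ω) ≤ (1 + opNorm D.A) * opNorm D.C⁻¹ * v_b := by
  have hCv : ∀ s, vecNorm (D.C⁻¹ *ᵥ v s ω) ≤ opNorm D.C⁻¹ * v_b := fun s =>
    (vecNorm_mulVec_le _ _).trans (mul_le_mul_of_nonneg_left (hv s) (opNorm_nonneg _))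
  have h1 : vecNorm (D.A *ᵥ (D.C⁻¹ *ᵥ v t ω)) ≤ opNorm D.A * (opNorm D.C⁻¹ * v_b) :=
    (vecNorm_mulVec_le _ _).trans (mul_le_mul_of_nonneg_left (hCv t) (opNorm_nonneg _))
  rw [noiseEst_eq hC, add_sub_cancel_left]
  calc _ ≤ _ := vecNorm_sub_le _ _
    _ ≤ opNorm D.C⁻¹ * v_b + opNorm D.A * (opNorm D.C⁻¹ * v_b) := add_le_add (hCv _) h1
    _ = _ := by ring

theorem atom_injective (hv0 : 0 ≤ v_b) (hsep : ∀ i j, i ≠ j →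
      2 * (1 + opNorm D.A) * opNorm D.C⁻¹ * v_b < vecNorm (D.atom i - D.atom j)) :
    Function.Injective D.atom := by
  intro i j hij
  by_contra hne
  have h := hsep i j hne
  have h0 : 0 ≤ 2 * (1 + opNorm D.A) * opNorm D.C⁻¹ * v_b := by
    have := opNorm_nonneg D.A
    have := opNorm_nonneg D.C⁻¹
    positivity
  rw [hij, sub_self] at h
  simp [vecNorm] at h
  linarith

/-- The error is less than half of every gap between atoms, so the triangle inequality puts each
wrong atom strictly farther from `ŵ(t)` than the true one. -/
theorem minimizer_iff (hC : IsUnit D.C.det) (hsep : ∀ i j, i ≠ j →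
      2 * (1 + opNorm D.A) * opNorm D.C⁻¹ * v_b < vecNorm (D.atom i - D.atom j)) {t : ℕ} {ω : Ω}
    (hv : ∀ t, vecNorm (v t ω) ≤ v_b) (hw : ∃ i, w t ω = D.atom i) (i : Fin M) :
    (∀ j, vecNorm (noiseEst D π x₀ w v t ω - D.atom i)
        ≤ vecNorm (noiseEst D π x₀ w v t ω - D.atom j)) ↔ w t ω = D.atom i := by
  obtain ⟨k, hk⟩ := hw
  have herr := vecNorm_noise_error_le (π := π) (x₀ := x₀) (w := w) (t := t) hC hv
  rw [hk] at herr ⊢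
  constructor
  · intro h
    by_contra hne
    have h1 := hsep k i fun e => hne (by rw [e])
    have h2 := vecNorm_sub_triangle (D.atom k) (noiseEst D π x₀ w v t ω) (D.atom i)
    have h3 := h k
    linarith
  · intro h j
    rw [← h]
    by_cases hj : k = j
    · rw [hj]
    · have h1 := hsep k j hj
      have h2 := vecNorm_sub_triangle (D.atom k) (noiseEst D π x₀ w v t ω) (D.atom j)
      linarith

theorem atom_nearestIndex [NeZero M] (hC : IsUnit D.C.det) (hsep : ∀ i j, i ≠ j →
      2 * (1 + opNorm D.A) * opNorm D.C⁻¹ * v_b < vecNorm (D.atom i - D.atom j)) {t : ℕ} {ω : Ω}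
    (hv : ∀ t, vecNorm (v t ω) ≤ v_b) (hw : ∃ i, w t ω = D.atom i) :
    D.atom (nearestIndex D.atom (noiseEst D π x₀ w v t ω)) = w t ω :=
  ((minimizer_iff hC hsep hv hw _).1 (nearestIndex_spec _ _)).symm

theorem historyProbEst_eq_probEst [NeZero M] (t : ℕ) (ω : Ω) :
    historyProbEst D t (fun s => output D π x₀ w v s ω) (fun s => input D π x₀ w v s ω)
      = probEst fun s : Fin t => nearestIndex D.atom (noiseEst D π x₀ w v s ω) := rfl

theorem probEst_apply {t : ℕ} (h : Fin t → Fin M) (i : Fin M) :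
    probEst h i = ({s : Fin t | h s = i}.ncard : ℝ) / t := by
  classical
  rw [Set.ncard_eq_toFinset_card', probEst, Pi.smul_apply, Finset.sum_apply, smul_eq_mul,
    one_div, div_eq_inv_mul]
  congr 1
  simp [Pi.single_apply, eq_comm, Finset.sum_boole]

theorem historyProbEst_eq_frequency [NeZero M] (hC : IsUnit D.C.det) (hsep : ∀ i j, i ≠ j →
      2 * (1 + opNorm D.A) * opNorm D.C⁻¹ * v_b < vecNorm (D.atom i - D.atom j)) {ω : Ω}
    (hv : ∀ t, vecNorm (v t ω) ≤ v_b) (hw : ∀ t, ∃ i, w t ω = D.atom i) (t : ℕ) (i : Fin M) :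
    historyProbEst D t (fun s => output D π x₀ w v s ω) (fun s => input D π x₀ w v s ω) i
      = ({s : Fin t | w s ω = D.atom i}.ncard : ℝ) / t := by
  rw [historyProbEst_eq_probEst, probEst_apply]
  -- `0 ≤ v_b` comes from the existence of a noise vector of norm at most `v_b`.
  have hinj := atom_injective ((vecNorm_nonneg _).trans (hv 0)) hsep
  congr 4
  ext s
  rw [← atom_nearestIndex (π := π) (x₀ := x₀) hC hsep hv (hw s), hinj.eq_iff]

/-- The sample mean of `w(0), …, w(t-1)`, equal to `0` for `t = 0`. -/
noncomputable def sampleMean (w : ℕ → Ω → Fin n → ℝ) (t : ℕ) (ω : Ω) : Fin n → ℝ :=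
  (1 / (t : ℝ)) • ∑ s : Fin t, w s ω

theorem meanOf_probEst (a : Fin M → Fin n → ℝ) {t : ℕ} (h : Fin t → Fin M) :
    meanOf a (probEst h) = (1 / (t : ℝ)) • ∑ s, a (h s) := by
  classical
  simp only [meanOf, probEst, Pi.smul_apply, Finset.sum_apply, smul_assoc, ← Finset.smul_sum,
    Finset.sum_smul]
  rw [Finset.sum_comm]
  simp [Pi.single_apply, ite_smul]

theorem meanOf_historyProbEst [NeZero M] (hC : IsUnit D.C.det) (hsep : ∀ i j, i ≠ j →
      2 * (1 + opNorm D.A) * opNorm D.C⁻¹ * v_b < vecNorm (D.atom i - D.atom j)) {ω : Ω}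
    (hv : ∀ t, vecNorm (v t ω) ≤ v_b) (hw : ∀ t, ∃ i, w t ω = D.atom i) (t : ℕ) :
    meanOf D.atom (historyProbEst D t (fun s => output D π x₀ w v s ω)
      (fun s => input D π x₀ w v s ω)) = sampleMean w t ω := by
  rw [historyProbEst_eq_probEst, meanOf_probEst, sampleMean]
  congr 1
  exact Finset.sum_congr rfl fun s _ => atom_nearestIndex hC hsep hv (hw s)

theorem state_eq_loopState (hC : IsUnit D.C.det) {T : ℕ} {ν : ℕ → Ω → Fin n → ℝ} {ω : Ω}
    (h : ∀ t, input D π x₀ w v t ω = feedback D T t (stateEst D π x₀ w v t ω) (ν t ω)) (t : ℕ) :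
    state D π x₀ w v t ω = loopState D T x₀ w v ν t ω ∧
      input D π x₀ w v t ω = loopInput D T x₀ w v ν t ω := by
  have hinp : ∀ t, state D π x₀ w v t ω = loopState D T x₀ w v ν t ω →
      input D π x₀ w v t ω = loopInput D T x₀ w v ν t ω := fun t ht => by
    rw [h, stateEst_eq hC, ht, loopInput]
  suffices hs : state D π x₀ w v t ω = loopState D T x₀ w v ν t ω from ⟨hs, hinp t hs⟩
  induction t with
  | zero => rfl
  | succ t ih => rw [state_succ, loopState_succ, ih, hinp t ih]

theorem input_learningPolicy [NeZero M] (hC : IsUnit D.C.det) (hsep : ∀ i j, i ≠ j →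
      2 * (1 + opNorm D.A) * opNorm D.C⁻¹ * v_b < vecNorm (D.atom i - D.atom j)) {ω : Ω}
    (hv : ∀ t, vecNorm (v t ω) ≤ v_b) (hw : ∀ t, ∃ i, w t ω = D.atom i) (T t : ℕ) :
    input D (learningPolicy D T) x₀ w v t ω
      = feedback D T t (stateEst D (learningPolicy D T) x₀ w v t ω) (sampleMean w t ω) := by
  rw [input_eq, ← meanOf_historyProbEst (π := learningPolicy D T) (x₀ := x₀) hC hsep hv hw t]
  rfl

theorem input_offlinePolicy (p : Fin M → ℝ) (T t : ℕ) (ω : Ω) :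
    input D (offlinePolicy D p T) x₀ w v t ω
      = feedback D T t (stateEst D (offlinePolicy D p T) x₀ w v t ω) (meanOf D.atom p) := by
  rw [input_eq]
  rfl

end Identification

/-! ### Mean squared error of the sample mean. -/

section Expectations

/-- The policy computes its estimate from outputs that contain `v(0), …, v(t)`; exact identification
makes it a function of the `w(s)` with `s < t` alone, hence independent of `v(t)` as the cost
computation requires. -/
theorem measurable_sampleMean {x₀ : Ω → Fin n → ℝ} {w v : ℕ → Ω → Fin n → ℝ} (t : ℕ) :
    Measurable[pastSigma x₀ w v t t] (sampleMean w t) := by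
  have hw : ∀ s : Fin t, Measurable[pastSigma x₀ w v t t] (w s) := fun s =>
    measurable_pastSigma x₀ w v (Sum.inr (Sum.inl (s : ℕ))) s.2
  have hs := Finset.measurable_fun_sum Finset.univ fun s _ => hw s
  exact hs.const_smul (1 / (t : ℝ))

theorem trace_mul_vecMulVec (N : Matrix (Fin n) (Fin n) ℝ) (z : Fin n → ℝ) :
    (N * vecMulVec z z).trace = z ⬝ᵥ (N *ᵥ z) := by
  rw [mul_vecMulVec, trace_vecMulVec, dotProduct_comm]

variable [MeasurableSpace Ω] {P : Measure Ω} [IsProbabilityMeasure P] {D : Model n m M}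
  {p : Fin M → ℝ} {x₀ : Ω → Fin n → ℝ} {w v ν : ℕ → Ω → Fin n → ℝ} {v_b : ℝ}

/-- Transfers `loop_cost` to any policy that almost surely acts as the feedback with `ν`. It serves
both policies, with the sample mean and with the constant `μ_w`. -/
theorem cost_of_certaintyEquivalent (hC : IsUnit D.C.det)
    (hQ : ∀ t, (D.Q t).PosSemidef) (hR : ∀ t, (D.R t).PosDef)
    (hPterm : ∀ T, (D.Pterm T).PosSemidef) (h : NoiseModel P D p x₀ w v v_b)
    (hνm : ∀ t, Measurable[pastSigma x₀ w v t t] (ν t)) (hν : ∀ t, MemLp (ν t) 2 P) {T : ℕ}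
    {π : Policy n m}
    (hπ : ∀ᵐ ω ∂P, ∀ t,
      input D π x₀ w v t ω = feedback D T t (stateEst D π x₀ w v t ω) (ν t ω)) :
    CostIntegrable P D π x₀ w v T ∧
    Integrable (fun ω =>
        (D.C⁻¹ *ᵥ (D.C *ᵥ x₀ ω + v 0 ω)) ⬝ᵥ
            (riccati D T 0 *ᵥ (D.C⁻¹ *ᵥ (D.C *ᵥ x₀ ω + v 0 ω)))
          + 2 * ((D.C⁻¹ *ᵥ (D.C *ᵥ x₀ ω + v 0 ω)) ⬝ᵥ
            (adjointL D T 0 *ᵥ meanOf D.atom p))) P ∧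
    cost P D π x₀ w v T
      = (∫ ω, ((D.C⁻¹ *ᵥ (D.C *ᵥ x₀ ω + v 0 ω)) ⬝ᵥ
            (riccati D T 0 *ᵥ (D.C⁻¹ *ᵥ (D.C *ᵥ x₀ ω + v 0 ω)))
          + 2 * ((D.C⁻¹ *ᵥ (D.C *ᵥ x₀ ω + v 0 ω)) ⬝ᵥ
            (adjointL D T 0 *ᵥ meanOf D.atom p))) ∂P)
        + hConst D p (D.C⁻¹ * momentMatrix P (v 0) * (D.C⁻¹)ᵀ) T
        + ∑ t ∈ Finset.range (T + 1),
          ∫ ω, (meanOf D.atom p - ν t ω) ⬝ᵥ (dMat D T t *ᵥ (meanOf D.atom p - ν t ω)) ∂P := by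
  have hloop : ∀ᵐ ω ∂P, ∀ t, state D π x₀ w v t ω = loopState D T x₀ w v ν t ω ∧
      input D π x₀ w v t ω = loopInput D T x₀ w v ν t ω := by
    filter_upwards [hπ] with ω hω using state_eq_loopState hC hω
  have hstage : ∀ t, stageCost D π x₀ w v t =ᵐ[P] fun ω =>
      loopState D T x₀ w v ν t ω ⬝ᵥ (D.Q t *ᵥ loopState D T x₀ w v ν t ω)
          + loopInput D T x₀ w v ν t ω ⬝ᵥ (D.R t *ᵥ loopInput D T x₀ w v ν t ω) := fun t => by
    filter_upwards [hloop] with ω hω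
    rw [stageCost, (hω t).1, (hω t).2]
  have hterm : terminalCost D π x₀ w v T =ᵐ[P] fun ω =>
      loopState D T x₀ w v ν (T + 1) ω ⬝ᵥ (D.Pterm T *ᵥ loopState D T x₀ w v ν (T + 1) ω) := by
    filter_upwards [hloop] with ω hω
    rw [terminalCost, (hω (T + 1)).1]
  have hval : (fun ω =>
        (D.C⁻¹ *ᵥ (D.C *ᵥ x₀ ω + v 0 ω)) ⬝ᵥ
            (riccati D T 0 *ᵥ (D.C⁻¹ *ᵥ (D.C *ᵥ x₀ ω + v 0 ω)))
          + 2 * ((D.C⁻¹ *ᵥ (D.C *ᵥ x₀ ω + v 0 ω)) ⬝ᵥ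
            (adjointL D T 0 *ᵥ meanOf D.atom p)))
      = valueAt D T x₀ w v ν (meanOf D.atom p) 0 := by
    funext ω
    have e : D.C⁻¹ *ᵥ (D.C *ᵥ x₀ ω + v 0 ω) = loopState D T x₀ w v ν 0 ω + D.C⁻¹ *ᵥ v 0 ω := by
      rw [mulVec_add, mulVec_mulVec, nonsing_inv_mul _ hC, one_mulVec]; rfl
    rw [e]; rfl
  rw [hval]
  refine ⟨⟨fun t _ => ?_, ?_⟩, integrable_valueAt h hν T 0 _, ?_⟩
  · exact ((integrable_quadratic _ (memLp_loop h hν T t).1).add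
      (integrable_quadratic _ (memLp_loop h hν T t).2)).congr (hstage t).symm
  · exact (integrable_quadratic _ (memLp_loop h hν T (T + 1)).1).congr hterm.symm
  · rw [← loop_cost hQ hR hPterm h hνm hν T, cost, integral_congr_ae hterm]
    congr 1
    exact Finset.sum_congr rfl fun t _ => integral_congr_ae (hstage t)

theorem memLp_sampleMean (h : NoiseModel P D p x₀ w v v_b) (t : ℕ) :
    MemLp (sampleMean w t) 2 P :=
  (memLp_finsetSum Finset.univ fun (s : Fin t) _ => h.w_memLp s).const_smul (1 / (t : ℝ))

theorem hasExpectation_centered_w (h : NoiseModel P D p x₀ w v v_b)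
    (N : Matrix (Fin n) (Fin n) ℝ) (s r : ℕ) :
    HasExpectation P (fun ω => (w s ω - meanOf D.atom p) ⬝ᵥ (N *ᵥ (w r ω - meanOf D.atom p)))
      (if s = r then (N * covariance D.atom p).trace else 0) := by
  have hc : ∀ s, MemLp (fun ω => w s ω - meanOf D.atom p) 2 P := fun s =>
    (h.w_memLp s).sub (memLp_const _)
  split_ifs with hsr
  · subst hsr
    have h1 := hasExpectation_quadratic N (h.w_memLp s)
    rw [h.momentMatrix_w] at h1
    have h2 := hasExpectation_const_dotProduct (Nᵀ *ᵥ meanOf D.atom p) (h.w_memLp s)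
    have h3 := hasExpectation_const_dotProduct (N *ᵥ meanOf D.atom p) (h.w_memLp s)
    rw [h.integral_w] at h2 h3
    have h4 := ((h1.sub h2).sub h3).add (.const (meanOf D.atom p ⬝ᵥ (N *ᵥ meanOf D.atom p)))
    convert h4 using 1
    · funext ω
      simp only [mulVec_sub, sub_dotProduct, dotProduct_sub]
      rw [dotProduct_mulVec_swap N (meanOf D.atom p), dotProduct_comm (w s ω) (N *ᵥ meanOf D.atom p),
        dotProduct_comm (w s ω) (Nᵀ *ᵥ _)]
      ring
    · rw [covariance, Matrix.mul_sub, trace_sub, trace_mul_vecMulVec, mulVec_dotProduct_transpose,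
        transpose_transpose, dotProduct_comm (N *ᵥ _)]
      ring
  · have hi : IndepFun (w s) (w r) P :=
      h.indep.indepFun (i := Sum.inr (Sum.inl s)) (j := Sum.inr (Sum.inl r)) (by simpa using hsr)
    have h0 : ∫ ω, (w r ω - meanOf D.atom p) ∂P = 0 := by
      rw [integral_sub ((h.w_memLp r).integrable one_le_two) (integrable_const _), h.integral_w]
      simp
    exact hasExpectation_bilinear_zero N (hc s) (hc r)
      (hi.comp (measurable_id.sub_const _) (measurable_id.sub_const _)) h0

/-- Of the `t²` pairs in the expanded square, only the `t` diagonal ones have nonzero expectation,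
against a prefactor `1/t²`. -/
theorem integral_sampleMean_error (h : NoiseModel P D p x₀ w v v_b)
    (N : Matrix (Fin n) (Fin n) ℝ) {t : ℕ} (ht : t ≠ 0) :
    ∫ ω, (meanOf D.atom p - sampleMean w t ω) ⬝ᵥ
        (N *ᵥ (meanOf D.atom p - sampleMean w t ω)) ∂P
      = (1 / (t : ℝ)) * (N * covariance D.atom p).trace := by
  have ht' : (t : ℝ) ≠ 0 := Nat.cast_ne_zero.2 ht
  have e : ∀ ω, meanOf D.atom p - sampleMean w t ω
      = (-(1 / (t : ℝ))) • ∑ s : Fin t, (w s ω - meanOf D.atom p) := fun ω => by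
    rw [Finset.sum_sub_distrib, sampleMean, Finset.sum_const, Finset.card_univ, Fintype.card_fin,
      smul_sub, neg_smul, neg_smul, ← Nat.cast_smul_eq_nsmul ℝ t, smul_smul, one_div_mul_cancel ht',
      one_smul]
    abel
  have hE := (HasExpectation.sum (s := Finset.univ) fun (s : Fin t) _ =>
    HasExpectation.sum (s := Finset.univ) fun (r : Fin t) _ =>
      hasExpectation_centered_w h N s r).const_mul ((1 / (t : ℝ)) * (1 / (t : ℝ)))
  have e2 : ∀ ω, (meanOf D.atom p - sampleMean w t ω) ⬝ᵥ
        (N *ᵥ (meanOf D.atom p - sampleMean w t ω))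
      = (1 / (t : ℝ)) * (1 / (t : ℝ)) * ∑ s : Fin t, ∑ r : Fin t,
        (w s ω - meanOf D.atom p) ⬝ᵥ (N *ᵥ (w r ω - meanOf D.atom p)) := fun ω => by
    rw [e, mulVec_smul, smul_dotProduct, dotProduct_smul, sum_dotProduct]
    simp only [mulVec_sum, dotProduct_sum, smul_eq_mul]
    ring
  rw [integral_congr_ae (ae_of_all _ e2), hE.2]
  simp only [← Fin.ext_iff, Finset.sum_ite_eq, Finset.mem_univ, if_true, Finset.sum_const,
    Finset.card_univ, Fintype.card_fin, nsmul_eq_mul]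
  field_simp

theorem sum_sampleMean_error (h : NoiseModel P D p x₀ w v v_b) (T : ℕ) :
    ∑ t ∈ Finset.range (T + 1), ∫ ω, (meanOf D.atom p - sampleMean w t ω) ⬝ᵥ
        (dMat D T t *ᵥ (meanOf D.atom p - sampleMean w t ω)) ∂P
      = (dMat D T 0 * vecMulVec (meanOf D.atom p) (meanOf D.atom p)).trace
        + ∑ t ∈ Finset.Icc 1 T, (1 / (t : ℝ)) * (dMat D T t * covariance D.atom p).trace := by
  have hr : Finset.range (T + 1) = insert 0 (Finset.Icc 1 T) := by
    ext t; simp; omega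
  rw [hr, Finset.sum_insert (by simp)]
  congr 1
  -- The sample mean is `0` at time 0, so the error is `μ_w` itself.
  · simp [sampleMean, trace_mul_vecMulVec]
  · refine Finset.sum_congr rfl fun t ht => integral_sampleMean_error h _ ?_
    have := (Finset.mem_Icc.1 ht).1
    omega

end Expectations

end OutputFeedback

/-! ### Bounded matrix recursions and LaSalle's principle. -/

namespace OutputFeedback

variable {n m M : ℕ}

section Sequences

/-- A sequence that contracts over blocks of length `N`, up to a constant, is bounded. -/
theorem bounded_of_block_contraction {a : ℕ → ℝ} {N k₀ : ℕ} {c : ℝ} (hN : 1 ≤ N)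
    (h : ∀ k, k₀ ≤ k → a (k + N) ≤ a k / 2 + c) : ∃ C, ∀ k, a k ≤ C := by
  obtain ⟨C₀, hC₀⟩ : ∃ C₀, ∀ k < k₀ + N, a k ≤ C₀ :=
    ((Finset.range (k₀ + N)).finite_toSet.image a).bddAbove.imp fun C hC k hk =>
      hC ⟨k, by simpa using hk, rfl⟩
  -- `2 * c` is the fixed point of `a ↦ a / 2 + c`; `C₀` covers the indices before the first
  -- contracting block has ended.
  refine ⟨max C₀ (2 * c), fun k => ?_⟩
  induction k using Nat.strong_induction_on with
  | _ k ih =>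
    by_cases hk : k < k₀ + N
    · exact (hC₀ k hk).trans (le_max_left _ _)
    · have h1 := h (k - N) (by omega)
      rw [Nat.sub_add_cancel (by omega)] at h1
      have h2 := ih (k - N) (by omega)
      have h3 := le_max_right C₀ (2 * c)
      linarith

theorem tendsto_pow_of_tendsto_mulVec {F : Matrix (Fin n) (Fin n) ℝ}
    (h : ∀ z, Tendsto (fun k : ℕ => (F ^ k) *ᵥ z) atTop (𝓝 0)) :
    Tendsto (fun k : ℕ => F ^ k) atTop (𝓝 0) := by
  refine tendsto_pi_nhds.2 fun i => tendsto_pi_nhds.2 fun j => ?_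
  have := (tendsto_pi_nhds.1 (h (Pi.single j 1))) i
  simpa [mulVec_single_one] using this

theorem tendsto_matrix_inv {A : ℕ → Matrix (Fin n) (Fin n) ℝ} {L : Matrix (Fin n) (Fin n) ℝ}
    (h : Tendsto A atTop (𝓝 L)) (hL : IsUnit L.det) :
    Tendsto (fun k => (A k)⁻¹) atTop (𝓝 L⁻¹) := by
  have h1 : Continuous fun X : Matrix (Fin n) (Fin n) ℝ => X.det := by fun_prop
  have h2 : Continuous fun X : Matrix (Fin n) (Fin n) ℝ => X.adjugate := by fun_prop
  simp only [Matrix.inv_def, Ring.inverse_eq_inv']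
  exact (((h1.tendsto L).comp h).inv₀ hL.ne_zero).smul ((h2.tendsto L).comp h)

theorem tendsto_matrix_mul {k l r : ℕ} {X : ℕ → Matrix (Fin k) (Fin l) ℝ}
    {Y : ℕ → Matrix (Fin l) (Fin r) ℝ} {X' : Matrix (Fin k) (Fin l) ℝ}
    {Y' : Matrix (Fin l) (Fin r) ℝ} (hX : Tendsto X atTop (𝓝 X')) (hY : Tendsto Y atTop (𝓝 Y')) :
    Tendsto (fun i => X i * Y i) atTop (𝓝 (X' * Y')) := by
  have hc : Continuous fun z : Matrix (Fin k) (Fin l) ℝ × Matrix (Fin l) (Fin r) ℝ => z.1 * z.2 := by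
    fun_prop
  exact (hc.tendsto (X', Y')).comp (hX.prodMk_nhds hY)

theorem tendsto_matrix_transpose {k l : ℕ} {X : ℕ → Matrix (Fin k) (Fin l) ℝ}
    {X' : Matrix (Fin k) (Fin l) ℝ} (hX : Tendsto X atTop (𝓝 X')) :
    Tendsto (fun i => (X i)ᵀ) atTop (𝓝 X'ᵀ) := by
  have hc : Continuous fun z : Matrix (Fin k) (Fin l) ℝ => zᵀ := by fun_prop
  exact (hc.tendsto X').comp hX

theorem tendsto_quadratic {X : ℕ → Matrix (Fin n) (Fin n) ℝ} {X' : Matrix (Fin n) (Fin n) ℝ}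
    (hX : Tendsto X atTop (𝓝 X')) (z : Fin n → ℝ) :
    Tendsto (fun i => z ⬝ᵥ (X i *ᵥ z)) atTop (𝓝 (z ⬝ᵥ (X' *ᵥ z))) := by
  have hc : Continuous fun Y : Matrix (Fin n) (Fin n) ℝ => z ⬝ᵥ (Y *ᵥ z) := by fun_prop
  exact (hc.tendsto X').comp hX

theorem posSemidef_of_tendsto {X : ℕ → Matrix (Fin n) (Fin n) ℝ} {X' : Matrix (Fin n) (Fin n) ℝ}
    (hX : Tendsto X atTop (𝓝 X')) (h : ∀ k, (X k).PosSemidef) : X'.PosSemidef := by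
  refine PosSemidef.of_dotProduct_mulVec_nonneg ?_ fun z => ?_
  · have h1 := tendsto_matrix_transpose hX
    simp only [posSemidef_transpose_eq (h _)] at h1
    simpa [IsHermitian] using tendsto_nhds_unique h1 hX
  · exact ge_of_tendsto' (tendsto_quadratic hX z) fun k => posSemidef_quadratic_nonneg (h k) z

/-- Symmetric matrices converge if their quadratic forms do. -/
theorem exists_tendsto_of_quadratic {X : ℕ → Matrix (Fin n) (Fin n) ℝ} (hs : ∀ k, (X k)ᵀ = X k)
    (h : ∀ z, ∃ q, Tendsto (fun k => z ⬝ᵥ (X k *ᵥ z)) atTop (𝓝 q)) :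
    ∃ X', Tendsto X atTop (𝓝 X') := by
  choose q hq using h
  -- Polarization recovers the entries from the quadratic form.
  refine ⟨Matrix.of fun i j =>
    (q (Pi.single i 1 + Pi.single j 1) - q (Pi.single i 1) - q (Pi.single j 1)) / 2,
    tendsto_pi_nhds.2 fun i => tendsto_pi_nhds.2 fun j => ?_⟩
  have h1 := (((hq (Pi.single i 1 + Pi.single j 1)).sub (hq (Pi.single i 1))).sub
    (hq (Pi.single j 1))).div_const 2
  refine h1.congr fun k => ?_
  have h2 : X k j i = X k i j := by
    conv_rhs => rw [← hs k]
    rfl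
  simp only [mulVec_add, add_dotProduct, dotProduct_add, mulVec_single_one, single_one_dotProduct,
    col_apply, h2]
  ring

end Sequences

section MatrixNorm

open scoped Matrix.Norms.Operator

theorem exists_norm_le_of_tendsto {k l : ℕ} {X : ℕ → Matrix (Fin k) (Fin l) ℝ}
    {X' : Matrix (Fin k) (Fin l) ℝ} (h : Tendsto X atTop (𝓝 X')) : ∃ C, ∀ i, ‖X i‖ ≤ C :=
  h.norm.bddAbove_range.imp fun _ hC i => hC ⟨i, rfl⟩

theorem abs_mulVec_apply_le {k l : ℕ} (X : Matrix (Fin k) (Fin l) ℝ) (z : Fin l → ℝ) (i : Fin k) :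
    |(X *ᵥ z) i| ≤ ‖X‖ * ‖z‖ :=
  (norm_le_pi_norm (X *ᵥ z) i).trans (linfty_opNorm_mulVec X z)

theorem abs_trace_le (X : Matrix (Fin n) (Fin n) ℝ) : |X.trace| ≤ n * ‖X‖ := by
  have h : ∀ i ∈ Finset.univ, |X i i| ≤ ‖X‖ := fun i _ => by
    simpa [mulVec_single_one, Pi.norm_single] using abs_mulVec_apply_le X (Pi.single i 1) i
  simpa [Matrix.trace] using (Finset.abs_sum_le_sum_abs _ _).trans (Finset.sum_le_sum h)

/-- The solution of the Lyapunov recursion of a stable matrix is bounded. -/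
theorem lyapunov_bounded {F W : Matrix (Fin n) (Fin n) ℝ} {Y : ℕ → Matrix (Fin n) (Fin n) ℝ}
    (hF : Tendsto (fun k : ℕ => F ^ k) atTop (𝓝 0)) (h0 : Y 0 = 0)
    (hY : ∀ k, Y (k + 1) = Fᵀ * Y k * F + W) : ∃ C, ∀ k, ‖Y k‖ ≤ C := by
  -- Since `Y 0 = 0`, the inhomogeneity accumulated over `j` steps is `Y j`, independently of `k`.
  have hadd : ∀ k j, Y (k + j) = (F ^ j)ᵀ * Y k * F ^ j + Y j := fun k j => by
    induction j with
    | zero => simp [h0]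
    | succ j ih =>
      rw [← add_assoc, hY, ih, hY]
      simp only [pow_succ, transpose_mul, Matrix.mul_add, Matrix.add_mul, Matrix.mul_assoc]
      abel
  have h1 : Tendsto (fun k : ℕ => ‖(F ^ k)ᵀ‖ * ‖F ^ k‖) atTop (𝓝 0) := by
    simpa using (tendsto_matrix_transpose hF).norm.mul hF.norm
  obtain ⟨N, hN, hN1⟩ := ((h1.eventually (gt_mem_nhds (show (0 : ℝ) < 1 / 2 by norm_num))).and
    (eventually_ge_atTop 1)).exists
  refine bounded_of_block_contraction (k₀ := 0) (c := ‖Y N‖) hN1 fun k _ => ?_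
  rw [hadd]
  calc _ ≤ ‖(F ^ N)ᵀ * Y k * F ^ N‖ + ‖Y N‖ := norm_add_le _ _
    _ ≤ ‖(F ^ N)ᵀ‖ * ‖Y k‖ * ‖F ^ N‖ + ‖Y N‖ := by
        gcongr
        exact (norm_mul_le _ _).trans (mul_le_mul_of_nonneg_right (norm_mul_le _ _) (norm_nonneg _))
    _ = (‖(F ^ N)ᵀ‖ * ‖F ^ N‖) * ‖Y k‖ + ‖Y N‖ := by ring
    _ ≤ 1 / 2 * ‖Y k‖ + ‖Y N‖ := by gcongr
    _ = _ := by ring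

/-- A linear recursion with bounded inhomogeneity, whose coefficients converge to a stable matrix,
has bounded solutions. -/
theorem recursion_bounded {G b x : ℕ → Matrix (Fin n) (Fin n) ℝ} {G' : Matrix (Fin n) (Fin n) ℝ}
    {β : ℝ} (hG : Tendsto G atTop (𝓝 G')) (hst : Tendsto (fun k : ℕ => G' ^ k) atTop (𝓝 0))
    (hb : ∀ k, ‖b k‖ ≤ β) (hx : ∀ k, x (k + 1) = G k * x k + b k) : ∃ C, ∀ k, ‖x k‖ ≤ C := by
  obtain ⟨γ, hγ⟩ := exists_norm_le_of_tendsto hG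
  have hγ0 : 0 ≤ γ := (norm_nonneg _).trans (hγ 0)
  -- Stability makes only high powers of `G'` small in norm. Over a block of `j` steps the
  -- coefficients multiply to a sequence converging to `G' ^ j`, with a remainder bounded uniformly
  -- in `k`.
  have hblock : ∀ j : ℕ, ∃ (H : ℕ → Matrix (Fin n) (Fin n) ℝ) (c : ℝ),
      Tendsto H atTop (𝓝 (G' ^ j)) ∧ ∀ k, ‖x (k + j) - H k * x k‖ ≤ c := fun j => by
    induction j with
    | zero => exact ⟨fun _ => 1, 0, by simp, fun k => by simp⟩
    | succ j ih =>
      obtain ⟨H, c, hH, hc⟩ := ih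
      refine ⟨fun k => G (k + j) * H k, γ * c + β, ?_, fun k => ?_⟩
      · rw [pow_succ']
        exact tendsto_matrix_mul (hG.comp (tendsto_add_atTop_nat j)) hH
      · have e : x (k + (j + 1)) - G (k + j) * H k * x k
            = G (k + j) * (x (k + j) - H k * x k) + b (k + j) := by
          rw [← add_assoc, hx, Matrix.mul_sub, Matrix.mul_assoc]; abel
        rw [e]
        refine (norm_add_le _ _).trans (add_le_add ((norm_mul_le _ _).trans ?_) (hb _))
        exact mul_le_mul (hγ _) (hc k) (norm_nonneg _) hγ0
  have hst' : Tendsto (fun k : ℕ => ‖G' ^ k‖) atTop (𝓝 0) := by simpa using hst.norm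
  obtain ⟨N, hN, hN1⟩ := ((hst'.eventually (gt_mem_nhds (show (0 : ℝ) < 1 / 2 by norm_num))).and
    (eventually_ge_atTop 1)).exists
  obtain ⟨H, c, hH, hc⟩ := hblock N
  obtain ⟨k₀, hk₀⟩ := eventually_atTop.1 (hH.norm.eventually (gt_mem_nhds hN))
  refine bounded_of_block_contraction (k₀ := k₀) (c := c) hN1 fun k hk => ?_
  calc ‖x (k + N)‖ = ‖H k * x k + (x (k + N) - H k * x k)‖ := by rw [add_sub_cancel]
    _ ≤ ‖H k‖ * ‖x k‖ + c := (norm_add_le _ _).trans (add_le_add (norm_mul_le _ _) (hc k))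
    _ ≤ 1 / 2 * ‖x k‖ + c := by
      have := (hk₀ k hk).le
      gcongr
    _ = _ := by ring

theorem exists_quadratic_le_of_norm_le {Y : ℕ → Matrix (Fin n) (Fin n) ℝ} {C : ℝ}
    (hY : ∀ k, ‖Y k‖ ≤ C) (z : Fin n → ℝ) : ∃ c, ∀ k, z ⬝ᵥ (Y k *ᵥ z) ≤ c := by
  refine ⟨∑ i, |z i| * (C * ‖z‖), fun k => Finset.sum_le_sum fun i _ => ?_⟩
  calc z i * (Y k *ᵥ z) i ≤ |z i| * |(Y k *ᵥ z) i| := by rw [← abs_mul]; exact le_abs_self _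
    _ ≤ |z i| * (C * ‖z‖) := by
      gcongr
      exact (abs_mulVec_apply_le _ _ _).trans (mul_le_mul_of_nonneg_right (hY k) (norm_nonneg _))

end MatrixNorm

section Orbits

open scoped MatrixOrder Matrix.Norms.L2Operator in
theorem exists_eq_transpose_mul_self {V : Matrix (Fin n) (Fin n) ℝ} (hV : V.PosSemidef) :
    ∃ N : Matrix (Fin n) (Fin n) ℝ, V = Nᵀ * N := by
  obtain ⟨N, hN⟩ := CStarAlgebra.nonneg_iff_eq_star_mul_self.mp hV.nonneg
  exact ⟨N, by simpa [star_eq_conjTranspose] using hN⟩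

/-- The sublevel sets of a positive definite quadratic form are bounded. -/
theorem exists_norm_le_of_quadratic_le {V : Matrix (Fin n) (Fin n) ℝ} (hV : V.PosDef) (a : ℝ) :
    ∃ r, ∀ z : Fin n → ℝ, z ⬝ᵥ (V *ᵥ z) ≤ a → ‖z‖ ≤ r := by
  obtain ⟨N, hN⟩ := exists_eq_transpose_mul_self hV.posSemidef
  have hdet : IsUnit N.det := by
    have h1 := (isUnit_iff_isUnit_det _).1 hV.isUnit
    rw [hN, det_mul] at h1
    exact isUnit_of_mul_isUnit_right h1
  -- With `V = N'N`, the sublevel set lies in the image under `N⁻¹` of a ball of radius `√a`.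
  obtain ⟨r, hr⟩ := ((isCompact_closedBall (0 : Fin n → ℝ) (Real.sqrt a)).image
    (f := fun y => N⁻¹ *ᵥ y) (by fun_prop)).isBounded.exists_norm_le
  refine ⟨r, fun z hz => hr _ ⟨N *ᵥ z, ?_, ?_⟩⟩
  · rw [hN, ← mulVec_mulVec, ← mulVec_dotProduct_transpose] at hz
    rw [mem_closedBall_zero_iff, pi_norm_le_iff_of_nonneg (Real.sqrt_nonneg _)]
    intro i
    refine Real.abs_le_sqrt (le_trans ?_ hz)
    rw [sq]
    exact Finset.single_le_sum (f := fun i => (N *ᵥ z) i * (N *ᵥ z) i)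
      (fun i _ => mul_self_nonneg _) (Finset.mem_univ i)
  · simp only [mulVec_mulVec, nonsing_inv_mul _ hdet, one_mulVec]

/-- LaSalle's principle for a linear system: if a positive definite quadratic form `V` decreases
along orbits by `z' W z`, where `W` is positive semidefinite and vanishes identically along no
orbit but zero, then all orbits tend to zero. -/
theorem tendsto_orbit_of_lyapunov {F V W : Matrix (Fin n) (Fin n) ℝ} (hV : V.PosSemidef)
    (hW : W.PosSemidef) (hstep : V = Fᵀ * V * F + W)
    (hobs : ∀ z, (∀ k : ℕ, ((F ^ k) *ᵥ z) ⬝ᵥ (W *ᵥ ((F ^ k) *ᵥ z)) = 0) → z = 0) (z : Fin n → ℝ) :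
    Tendsto (fun k : ℕ => (F ^ k) *ᵥ z) atTop (𝓝 0) := by
  have hdec : ∀ y : Fin n → ℝ, y ⬝ᵥ (V *ᵥ y)
      = (F *ᵥ y) ⬝ᵥ (V *ᵥ (F *ᵥ y)) + y ⬝ᵥ (W *ᵥ y) := fun y => by
    conv_lhs => rw [hstep]
    rw [add_mulVec, dotProduct_add, mulVec_dotProduct_transpose]
    simp only [mulVec_mulVec, Matrix.mul_assoc]
  have hsucc : ∀ (k : ℕ) (y : Fin n → ℝ), (F ^ (k + 1)) *ᵥ y = F *ᵥ ((F ^ k) *ᵥ y) := fun k y => by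
    rw [mulVec_mulVec, pow_succ']
  have hVn := posSemidef_quadratic_nonneg hV
  have hWn := posSemidef_quadratic_nonneg hW
  -- If `V` vanishes at `y`, it vanishes along the whole orbit, hence so do its decrements, and
  -- observability gives `y = 0`.
  have hpd : V.PosDef := by
    refine PosDef.of_dotProduct_mulVec_pos hV.isHermitian fun y hy => ?_
    rw [star_trivial]
    refine lt_of_le_of_ne (hVn y) fun h0 => hy (hobs y fun k => ?_)
    have hz : ∀ k : ℕ, ((F ^ k) *ᵥ y) ⬝ᵥ (V *ᵥ ((F ^ k) *ᵥ y)) = 0 := fun k => by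
      induction k with
      | zero => simpa using h0.symm
      | succ k ih =>
        have h1 := hdec ((F ^ k) *ᵥ y)
        rw [hsucc]
        linarith [hVn (F *ᵥ ((F ^ k) *ᵥ y)), hWn ((F ^ k) *ᵥ y)]
    have h1 := hdec ((F ^ k) *ᵥ y)
    rw [← hsucc] at h1
    linarith [hz k, hz (k + 1)]
  set f : ℕ → ℝ := fun k => ((F ^ k) *ᵥ z) ⬝ᵥ (V *ᵥ ((F ^ k) *ᵥ z)) with hf
  have hfs : ∀ k, f k = f (k + 1) + ((F ^ k) *ᵥ z) ⬝ᵥ (W *ᵥ ((F ^ k) *ᵥ z)) := fun k => by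
    rw [hf]; simp only [hsucc]; exact hdec _
  have hanti : Antitone f := antitone_nat_of_succ_le fun k => by
    linarith [hfs k, hWn ((F ^ k) *ᵥ z)]
  have hlim := tendsto_atTop_ciInf hanti ⟨0, by rintro _ ⟨k, rfl⟩; exact hVn _⟩
  have hq : Tendsto (fun k : ℕ => ((F ^ k) *ᵥ z) ⬝ᵥ (W *ᵥ ((F ^ k) *ᵥ z))) atTop (𝓝 0) := by
    have h1 := hlim.sub (hlim.comp (tendsto_add_atTop_nat 1))
    rw [sub_self] at h1
    refine h1.congr fun k => ?_
    simp only [Function.comp_apply]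
    linarith [hfs k]
  obtain ⟨r, hr⟩ := exists_norm_le_of_quadratic_le hpd (f 0)
  -- The orbit stays in a compact sublevel set. As the decrements tend to zero, `W` vanishes along
  -- the orbit of every cluster point, so `0` is the only one.
  refine (isCompact_closedBall (0 : Fin n → ℝ) r).tendsto_nhds_of_unique_mapClusterPt
    (Eventually.of_forall fun k => mem_closedBall_zero_iff.2 (hr _ (hanti (Nat.zero_le k))))
    fun y _ hy => hobs y fun j => ?_
  obtain ⟨ψ, hψ, hy'⟩ := hy.tendsto_subseq
  have hc : Continuous fun x : Fin n → ℝ => ((F ^ j) *ᵥ x) ⬝ᵥ (W *ᵥ ((F ^ j) *ᵥ x)) := by fun_prop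
  have l1 := (hc.tendsto y).comp hy'
  have l2 := (hq.comp (tendsto_add_atTop_nat j)).comp hψ.tendsto_atTop
  refine tendsto_nhds_unique l1 (l2.congr fun k => ?_)
  have e : (F ^ j) *ᵥ ((F ^ ψ k) *ᵥ z) = (F ^ (ψ k + j)) *ᵥ z := by
    rw [mulVec_mulVec, ← pow_add, add_comm]
  simp only [Function.comp_apply, e]

end Orbits

end OutputFeedback

/-! ### Convergence of the Riccati iteration and boundedness of `D_T(t)`. -/

namespace OutputFeedback

variable {n m M : ℕ}

section RiccatiIteration

/-- The iterates of the Riccati map from `0`. -/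
noncomputable def riccatiIter (A : Matrix (Fin n) (Fin n) ℝ) (B : Matrix (Fin n) (Fin m) ℝ)
    (Q : Matrix (Fin n) (Fin n) ℝ) (R : Matrix (Fin m) (Fin m) ℝ) : ℕ → Matrix (Fin n) (Fin n) ℝ
  | 0 => 0
  | k + 1 => riccatiMap A B Q R (riccatiIter A B Q R k)

/-- The iterates of the adjoint recursion along `riccatiIter`. -/
noncomputable def adjointIter (A : Matrix (Fin n) (Fin n) ℝ) (B : Matrix (Fin n) (Fin m) ℝ)
    (Q : Matrix (Fin n) (Fin n) ℝ) (R : Matrix (Fin m) (Fin m) ℝ) : ℕ → Matrix (Fin n) (Fin n) ℝ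
  | 0 => 0
  | k + 1 => (A - B * riccatiGain A B R (riccatiIter A B Q R k))ᵀ
      * (riccatiIter A B Q R k + adjointIter A B Q R k)

variable {A : Matrix (Fin n) (Fin n) ℝ} {B : Matrix (Fin n) (Fin m) ℝ}
  {Q P P' : Matrix (Fin n) (Fin n) ℝ} {R : Matrix (Fin m) (Fin m) ℝ}

theorem riccatiIter_posSemidef (hQ : Q.PosSemidef) (hR : R.PosDef) (k : ℕ) :
    (riccatiIter A B Q R k).PosSemidef := by
  induction k with
  | zero => exact PosSemidef.zero
  | succ k ih => exact riccatiMap_posSemidef ih hR hQ A B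

/-- The Riccati map is below the cost of every linear feedback. -/
theorem riccatiMap_quadratic_le (hP : P.PosSemidef) (hR : R.PosDef) (K : Matrix (Fin m) (Fin n) ℝ)
    (z : Fin n → ℝ) :
    z ⬝ᵥ (riccatiMap A B Q R P *ᵥ z)
      ≤ z ⬝ᵥ (((A - B * K)ᵀ * P * (A - B * K) + Q + Kᵀ * R * K) *ᵥ z) := by
  rw [riccatiMap_completion hP hR A B Q K, add_mulVec, dotProduct_add]
  exact le_add_of_nonneg_right (posSemidef_quadratic_nonneg (posSemidef_transpose_mul_mul
    (inputWeight_posDef hP hR B).posSemidef _) z)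

theorem quadratic_transpose_mul_mul (F P : Matrix (Fin n) (Fin n) ℝ) (z : Fin n → ℝ) :
    z ⬝ᵥ ((Fᵀ * P * F) *ᵥ z) = (F *ᵥ z) ⬝ᵥ (P *ᵥ (F *ᵥ z)) := by
  rw [mulVec_dotProduct_transpose]
  simp only [mulVec_mulVec, Matrix.mul_assoc]

theorem closedLoop_quadratic_mono (h : ∀ z, z ⬝ᵥ (P *ᵥ z) ≤ z ⬝ᵥ (P' *ᵥ z))
    (F W W' : Matrix (Fin n) (Fin n) ℝ) (z : Fin n → ℝ) :
    z ⬝ᵥ ((Fᵀ * P * F + W + W') *ᵥ z) ≤ z ⬝ᵥ ((Fᵀ * P' * F + W + W') *ᵥ z) := by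
  simp only [add_mulVec, dotProduct_add, quadratic_transpose_mul_mul]
  linarith [h (F *ᵥ z)]

/-- The gain that is optimal for `P'` is admissible for `P`, and for a fixed gain the closed-loop
form is monotone. -/
theorem riccatiMap_mono (hP : P.PosSemidef) (hP' : P'.PosSemidef) (hR : R.PosDef)
    (h : ∀ z, z ⬝ᵥ (P *ᵥ z) ≤ z ⬝ᵥ (P' *ᵥ z)) (z : Fin n → ℝ) :
    z ⬝ᵥ (riccatiMap A B Q R P *ᵥ z) ≤ z ⬝ᵥ (riccatiMap A B Q R P' *ᵥ z) := by
  rw [riccatiMap_eq_closedLoop hP' hR A B Q]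
  exact (riccatiMap_quadratic_le hP hR _ z).trans (closedLoop_quadratic_mono h _ _ _ z)

theorem riccatiIter_mono (hQ : Q.PosSemidef) (hR : R.PosDef) (z : Fin n → ℝ) :
    Monotone fun k => z ⬝ᵥ (riccatiIter A B Q R k *ᵥ z) := by
  refine monotone_nat_of_le_succ fun k => ?_
  induction k generalizing z with
  | zero =>
    simpa [riccatiIter] using posSemidef_quadratic_nonneg
      (riccatiIter_posSemidef (A := A) (B := B) hQ hR 1) z
  | succ k ih =>
    exact riccatiMap_mono (riccatiIter_posSemidef hQ hR k) (riccatiIter_posSemidef hQ hR (k + 1))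
      hR ih z

/-- The optimal cost is at most that of a fixed stabilizing feedback, which solves a Lyapunov
recursion. The sign of `K` is flipped because the Riccati lemmas use `A - B * K`. -/
theorem riccatiIter_bounded (hQ : Q.PosSemidef) (hR : R.PosDef) (hst : Stabilizable A B)
    (z : Fin n → ℝ) : ∃ c, ∀ k, z ⬝ᵥ (riccatiIter A B Q R k *ᵥ z) ≤ c := by
  obtain ⟨K, hK⟩ := hst
  set W := Q + (-K)ᵀ * R * (-K)
  have hF : A - B * (-K) = A + B * K := by rw [Matrix.mul_neg, sub_neg_eq_add]
  let Y : ℕ → Matrix (Fin n) (Fin n) ℝ := fun k =>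
    Nat.rec 0 (fun _ X => (A + B * K)ᵀ * X * (A + B * K) + W) k
  obtain ⟨C, hC⟩ := lyapunov_bounded (Y := Y) (W := W) (tendsto_pow_of_tendsto_mulVec hK) rfl
    fun k => rfl
  obtain ⟨c, hc⟩ := exists_quadratic_le_of_norm_le hC z
  have hle : ∀ k (z : Fin n → ℝ), z ⬝ᵥ (riccatiIter A B Q R k *ᵥ z) ≤ z ⬝ᵥ (Y k *ᵥ z) := fun k => by
    induction k with
    | zero => intro z; exact le_rfl
    | succ k ih =>
      intro z
      refine (riccatiMap_quadratic_le (riccatiIter_posSemidef hQ hR k) hR (-K) z).trans ?_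
      rw [hF]
      refine (closedLoop_quadratic_mono ih _ _ _ z).trans_eq ?_
      rw [add_assoc]
  exact ⟨c, fun k => (hle k z).trans (hc k)⟩

theorem riccatiIter_tendsto (hQ : Q.PosSemidef) (hR : R.PosDef) (hst : Stabilizable A B) :
    ∃ V, Tendsto (riccatiIter A B Q R) atTop (𝓝 V) := by
  refine exists_tendsto_of_quadratic
    (fun k => posSemidef_transpose_eq (riccatiIter_posSemidef hQ hR k)) fun z => ?_
  obtain ⟨c, hc⟩ := riccatiIter_bounded hQ hR hst z
  exact ⟨_, tendsto_atTop_ciSup (riccatiIter_mono hQ hR z) ⟨c, by rintro _ ⟨k, rfl⟩; exact hc k⟩⟩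

theorem tendsto_inputWeight_inv {X : ℕ → Matrix (Fin n) (Fin n) ℝ} {V : Matrix (Fin n) (Fin n) ℝ}
    (hX : Tendsto X atTop (𝓝 V)) (hV : V.PosSemidef) (hR : R.PosDef) :
    Tendsto (fun k => (R + Bᵀ * X k * B)⁻¹) atTop (𝓝 (R + Bᵀ * V * B)⁻¹) :=
  tendsto_matrix_inv (tendsto_const_nhds.add (tendsto_matrix_mul
    (tendsto_matrix_mul tendsto_const_nhds hX) tendsto_const_nhds))
    ((isUnit_iff_isUnit_det _).1 (inputWeight_posDef hV hR B).isUnit)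

theorem tendsto_riccatiGain {X : ℕ → Matrix (Fin n) (Fin n) ℝ} {V : Matrix (Fin n) (Fin n) ℝ}
    (hX : Tendsto X atTop (𝓝 V)) (hV : V.PosSemidef) (hR : R.PosDef) :
    Tendsto (fun k => riccatiGain A B R (X k)) atTop (𝓝 (riccatiGain A B R V)) :=
  tendsto_matrix_mul (tendsto_inputWeight_inv hX hV hR) (tendsto_matrix_mul
    (tendsto_matrix_mul tendsto_const_nhds hX) tendsto_const_nhds)

theorem riccatiMap_eq_sub (A : Matrix (Fin n) (Fin n) ℝ) (B : Matrix (Fin n) (Fin m) ℝ)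
    (Q : Matrix (Fin n) (Fin n) ℝ) (R : Matrix (Fin m) (Fin m) ℝ) (P : Matrix (Fin n) (Fin n) ℝ) :
    riccatiMap A B Q R P = Aᵀ * P * A + Q - Aᵀ * P * B * riccatiGain A B R P := by
  simp only [riccatiMap, riccatiGain, Matrix.mul_assoc]

theorem riccatiMap_fixedPoint (hQ : Q.PosSemidef) (hR : R.PosDef)
    {V : Matrix (Fin n) (Fin n) ℝ} (hV : Tendsto (riccatiIter A B Q R) atTop (𝓝 V)) :
    riccatiMap A B Q R V = V := by
  have hVp := posSemidef_of_tendsto hV (riccatiIter_posSemidef hQ hR)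
  have hAV := tendsto_matrix_mul (tendsto_const_nhds (x := Aᵀ)) hV
  have h1 : Tendsto (fun k => riccatiIter A B Q R (k + 1)) atTop (𝓝 (riccatiMap A B Q R V)) := by
    simp only [riccatiIter, riccatiMap_eq_sub]
    exact ((tendsto_matrix_mul hAV tendsto_const_nhds).add tendsto_const_nhds).sub
      (tendsto_matrix_mul (tendsto_matrix_mul hAV tendsto_const_nhds)
        (tendsto_riccatiGain hV hVp hR))
  exact tendsto_nhds_unique h1 (hV.comp (tendsto_add_atTop_nat 1))

theorem closedLoop_transpose (hP : P.PosSemidef) (hR : R.PosDef) (A : Matrix (Fin n) (Fin n) ℝ)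
    (B : Matrix (Fin n) (Fin m) ℝ) : (A - B * riccatiGain A B R P)ᵀ
      = Aᵀ - Aᵀ * P * B * (R + Bᵀ * P * B)⁻¹ * Bᵀ := by
  have hi := posSemidef_transpose_eq (inputWeight_posDef hP hR B).inv.posSemidef
  rw [riccatiGain]
  generalize (R + Bᵀ * P * B)⁻¹ = Z at hi ⊢
  simp only [transpose_sub, transpose_mul, posSemidef_transpose_eq hP, hi, transpose_transpose,
    Matrix.mul_assoc]

/-- The closed loop of the limiting Riccati solution is stable. -/
theorem closedLoop_stable {S V : Matrix (Fin n) (Fin n) ℝ} (hS : S.PosSemidef) (hR : R.PosDef)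
    (hobs : Observable A S) (hVp : V.PosSemidef) (hV : riccatiMap A B (S * S) R V = V)
    (z : Fin n → ℝ) :
    Tendsto (fun k : ℕ => ((A - B * riccatiGain A B R V) ^ k) *ᵥ z) atTop (𝓝 0) := by
  set G := riccatiGain A B R V with hG
  have hSt := posSemidef_transpose_eq hS
  have hSS : (S * S).PosSemidef := by
    have := posSemidef_transpose_mul_mul PosSemidef.one S
    rwa [Matrix.mul_one, hSt] at this
  have hGR := posSemidef_transpose_mul_mul hR.posSemidef G
  have hstep : V = (A - B * G)ᵀ * V * (A - B * G) + (S * S + Gᵀ * R * G) := by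
    conv_lhs => rw [← hV, riccatiMap_eq_closedLoop hVp hR, ← hG, add_assoc]
  have hzero : ∀ y : Fin n → ℝ, y ⬝ᵥ ((S * S + Gᵀ * R * G) *ᵥ y) = 0 →
      S *ᵥ y = 0 ∧ G *ᵥ y = 0 := fun y hy => by
    have e1 := posSemidef_quadratic_nonneg hSS y
    have e2 := posSemidef_quadratic_nonneg hGR y
    rw [add_mulVec, dotProduct_add] at hy
    have e3 : y ⬝ᵥ ((S * S) *ᵥ y) = 0 := by linarith
    have e4 : y ⬝ᵥ ((Gᵀ * R * G) *ᵥ y) = 0 := by linarith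
    constructor
    · rw [← mulVec_mulVec] at e3
      nth_rewrite 1 [← hSt] at e3
      rw [← mulVec_dotProduct_transpose] at e3
      exact dotProduct_self_eq_zero.1 e3
    · rw [Matrix.mul_assoc, ← mulVec_mulVec, ← mulVec_mulVec, ← mulVec_dotProduct_transpose] at e4
      by_contra hne
      have := hR.dotProduct_mulVec_pos hne
      rw [star_trivial] at this
      linarith
  refine tendsto_orbit_of_lyapunov hVp (hSS.add hGR) hstep (fun y hy => hobs y fun k => ?_) z
  -- The gain vanishes along such an orbit, so closed and open loop agree there and observability of
  -- `(A, S)` applies.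
  have hpow : ∀ k : ℕ, ((A - B * G) ^ k) *ᵥ y = (A ^ k) *ᵥ y := fun k => by
    induction k with
    | zero => simp
    | succ k ih =>
      have h2 := (hzero _ (hy k)).2
      rw [pow_succ', ← mulVec_mulVec, sub_mulVec, ← mulVec_mulVec, h2, mulVec_zero, sub_zero, ih,
        mulVec_mulVec, ← pow_succ']
  rw [← hpow]
  exact (hzero _ (hy k)).1

open scoped Matrix.Norms.Operator in
-- The coefficients are transposed closed-loop matrices. They converge to a stable limit, and the
-- inhomogeneity converges with the Riccati iterates, so `recursion_bounded` applies.
theorem adjointIter_bounded {S : Matrix (Fin n) (Fin n) ℝ} (hS : S.PosSemidef) (hR : R.PosDef)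
    (hst : Stabilizable A B) (hobs : Observable A S) :
    ∃ C, ∀ k, ‖adjointIter A B (S * S) R k‖ ≤ C := by
  have hSS : (S * S).PosSemidef := by
    have := posSemidef_transpose_mul_mul PosSemidef.one S
    rwa [Matrix.mul_one, posSemidef_transpose_eq hS] at this
  obtain ⟨V, hV⟩ := riccatiIter_tendsto hSS hR hst
  have hVp := posSemidef_of_tendsto hV (riccatiIter_posSemidef hSS hR)
  have hstable := tendsto_matrix_transpose (tendsto_pow_of_tendsto_mulVec
    (closedLoop_stable hS hR hobs hVp (riccatiMap_fixedPoint hSS hR hV)))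
  simp only [transpose_pow, transpose_zero] at hstable
  have hG := tendsto_matrix_transpose ((tendsto_const_nhds (x := A)).sub
    (tendsto_matrix_mul (tendsto_const_nhds (x := B)) (tendsto_riccatiGain (A := A) (B := B) hV hVp hR)))
  obtain ⟨β, hβ⟩ := exists_norm_le_of_tendsto (tendsto_matrix_mul hG hV)
  exact recursion_bounded hG hstable hβ fun k => by
    rw [adjointIter, Matrix.mul_add, add_comm]

end RiccatiIteration

open scoped Matrix.Norms.Operator in
-- The maximal row sum norm is not invariant under transposition, but a dimensional factor is
-- harmless here.
theorem norm_transpose_le (X : Matrix (Fin n) (Fin n) ℝ) : ‖Xᵀ‖ ≤ n * ‖X‖ := by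
  have h : ∀ i j, ‖X j i‖₊ ≤ ‖X‖₊ := fun i j => NNReal.coe_le_coe.1 (by
    simpa [mulVec_single_one, Pi.norm_single] using abs_mulVec_apply_le X (Pi.single i 1) j)
  have h2 : (Finset.univ.sup fun i => ∑ j, ‖Xᵀ i j‖₊) ≤ n * ‖X‖₊ := Finset.sup_le fun i _ =>
    (Finset.sum_le_sum fun j _ => h i j).trans (by simp)
  rw [linfty_opNorm_def Xᵀ]
  exact_mod_cast h2

section HorizonShift

variable {D : Model n m M}

/-- Only the number of steps to go matters, so bounds uniform in `T` and `t` reduce to bounds along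
one sequence. -/
theorem riccati_eq_riccatiIter (hQc : ∀ t, D.Q t = D.Q 0) (hRc : ∀ t, D.R t = D.R 0)
    (hPc : ∀ T, D.Pterm T = 0) {T t : ℕ} (ht : t ≤ T + 1) :
    riccati D T t = riccatiIter D.A D.B (D.Q 0) (D.R 0) (T + 1 - t) := by
  induction ht using Nat.decreasingInduction with
  | self => rw [riccati_of_lt D (Nat.lt_succ_self T), Nat.sub_self, hPc]; rfl
  | of_succ k hk ih =>
    rw [riccati_of_le D (Nat.lt_succ_iff.1 hk), ih, hQc k, hRc k,
      show T + 1 - k = (T + 1 - (k + 1)) + 1 by omega]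
    rfl

theorem adjointL_eq_adjointIter (hQ : (D.Q 0).PosSemidef) (hR : (D.R 0).PosDef)
    (hQc : ∀ t, D.Q t = D.Q 0) (hRc : ∀ t, D.R t = D.R 0)
    (hPc : ∀ T, D.Pterm T = 0) {T t : ℕ} (ht : t ≤ T + 1) :
    adjointL D T t = adjointIter D.A D.B (D.Q 0) (D.R 0) (T + 1 - t) := by
  induction ht using Nat.decreasingInduction with
  | self => rw [adjointL_of_lt D (Nat.lt_succ_self T), Nat.sub_self]; rfl
  | of_succ k hk ih =>
    rw [adjointL_of_le D (Nat.lt_succ_iff.1 hk), ih, upsilon,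
      riccati_eq_riccatiIter hQc hRc hPc (show k + 1 ≤ T + 1 by omega), hRc k,
      show T + 1 - k = (T + 1 - (k + 1)) + 1 by omega, adjointIter]
    rw [closedLoop_transpose (riccatiIter_posSemidef hQ hR _) hR]

open scoped Matrix.Norms.Operator in
theorem dMat_trace_bounded (hR : (D.R 0).PosDef)
    (hQc : ∀ t, D.Q t = D.Q 0) (hRc : ∀ t, D.R t = D.R 0)
    (hPc : ∀ T, D.Pterm T = 0) (hst : Stabilizable D.A D.B)
    (hobs : ∃ S : Matrix (Fin n) (Fin n) ℝ, S.PosSemidef ∧ S * S = D.Q 0 ∧ Observable D.A S)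
    (N : Matrix (Fin n) (Fin n) ℝ) : ∃ c, ∀ T t, t ≤ T → |(dMat D T t * N).trace| ≤ c := by
  obtain ⟨S, hS, hSQ, hobs⟩ := hobs
  have hSS : (S * S).PosSemidef := by
    have := posSemidef_transpose_mul_mul PosSemidef.one S
    rwa [Matrix.mul_one, posSemidef_transpose_eq hS] at this
  obtain ⟨V, hV⟩ := riccatiIter_tendsto hSS hR hst
  have hVp := posSemidef_of_tendsto hV (riccatiIter_posSemidef hSS hR)
  obtain ⟨C, hC⟩ := adjointIter_bounded hS hR hst hobs
  obtain ⟨p, hp⟩ := exists_norm_le_of_tendsto hV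
  obtain ⟨υ, hυ⟩ := exists_norm_le_of_tendsto (tendsto_matrix_mul (tendsto_matrix_mul
    (tendsto_const_nhds (x := D.B)) (tendsto_inputWeight_inv (B := D.B) hV hVp hR))
    (tendsto_const_nhds (x := D.Bᵀ)))
  -- One factor `n` comes from the trace, the other from the transpose; `υ` bounds `BΥ⁻¹B'` and `p +
  -- C` bounds `P + L`.
  refine ⟨n * (n * (p + C) * υ * (p + C) * ‖N‖), fun T t ht => (abs_trace_le _).trans ?_⟩
  have hP := riccati_eq_riccatiIter hQc hRc hPc (show t + 1 ≤ T + 1 by omega)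
  have hL := adjointL_eq_adjointIter (hSQ ▸ hSS) hR hQc hRc hPc (show t + 1 ≤ T + 1 by omega)
  rw [← hSQ] at hP hL
  rw [dMat, upsilon, hRc t, hP, hL]
  set k := T + 1 - (t + 1)
  set G := riccatiIter D.A D.B (S * S) (D.R 0) k + adjointIter D.A D.B (S * S) (D.R 0) k with hG
  have hGn : ‖G‖ ≤ p + C := (norm_add_le _ _).trans (add_le_add (hp k) (hC k))
  have hpC : 0 ≤ p + C := (norm_nonneg _).trans hGn
  rw [Matrix.mul_assoc Gᵀ, Matrix.mul_assoc Gᵀ]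
  refine mul_le_mul_of_nonneg_left ?_ (Nat.cast_nonneg n)
  have hυ0 : 0 ≤ υ := (norm_nonneg _).trans (hυ 0)
  have h1 : ‖Gᵀ‖ ≤ n * (p + C) :=
    (norm_transpose_le G).trans (mul_le_mul_of_nonneg_left hGn (Nat.cast_nonneg n))
  refine (norm_mul_le _ _).trans (mul_le_mul_of_nonneg_right ?_ (norm_nonneg _))
  refine (norm_mul_le _ _).trans (mul_le_mul ?_ hGn (norm_nonneg _) (by positivity))
  exact (norm_mul_le _ _).trans (mul_le_mul h1 (hυ k) (norm_nonneg _) (by positivity))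

end HorizonShift

theorem isBigO_log_of_harmonic_bound {f : ℕ → ℝ} {g : ℕ → ℕ → ℝ} {a : ℕ → ℝ} {c₀ c : ℝ}
    (hf : ∀ T, f T = a T + ∑ t ∈ Finset.Icc 1 T, (1 / (t : ℝ)) * g T t) (ha : ∀ T, |a T| ≤ c₀)
    (hg : ∀ T, ∀ t ≤ T, |g T t| ≤ c) : f =O[atTop] fun T : ℕ => Real.log T := by
  have hc : 0 ≤ c := (abs_nonneg _).trans (hg 0 0 le_rfl)
  have hc₀ : 0 ≤ c₀ := (abs_nonneg _).trans (ha 0)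
  -- From `T = 3` on, `log T ≥ 1`, so `c₀ + (1 + log T) c ≤ (c₀ + 2c) log T`.
  refine Asymptotics.IsBigO.of_bound (c₀ + 2 * c) ?_
  filter_upwards [eventually_ge_atTop 3] with T hT
  have hlog : 1 ≤ Real.log T := by
    rw [Real.le_log_iff_exp_le (by positivity)]
    have : (3 : ℝ) ≤ T := by exact_mod_cast hT
    linarith [Real.exp_one_lt_d9]
  have hsum : |∑ t ∈ Finset.Icc 1 T, (1 / (t : ℝ)) * g T t| ≤ (1 + Real.log T) * c := by
    have hH : ∑ t ∈ Finset.Icc 1 T, (1 / (t : ℝ)) ≤ 1 + Real.log T := by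
      have := harmonic_le_one_add_log T
      rw [harmonic_eq_sum_Icc] at this
      push_cast at this
      simpa using this
    calc _ ≤ ∑ t ∈ Finset.Icc 1 T, |(1 / (t : ℝ)) * g T t| := Finset.abs_sum_le_sum_abs _ _
      _ ≤ ∑ t ∈ Finset.Icc 1 T, (1 / (t : ℝ)) * c := Finset.sum_le_sum fun t ht => by
          rw [abs_mul, abs_of_nonneg (by positivity : (0 : ℝ) ≤ 1 / t)]
          exact mul_le_mul_of_nonneg_left (hg T t (Finset.mem_Icc.1 ht).2) (by positivity)
      _ = (∑ t ∈ Finset.Icc 1 T, (1 / (t : ℝ))) * c := by rw [Finset.sum_mul]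
      _ ≤ _ := mul_le_mul_of_nonneg_right hH hc
  rw [Real.norm_eq_abs, Real.norm_of_nonneg (by linarith), hf]
  refine (abs_add_le _ _).trans ?_
  nlinarith [ha T]

end OutputFeedback

/-! ### Assembly of the four claims. -/

theorem theorem5 {n m M : ℕ} [NeZero M] {Ω : Type*} [MeasurableSpace Ω]
    (P : Measure Ω) [IsProbabilityMeasure P]
    (D : OutputFeedback.Model n m M)
    -- the measurement matrix is nonsingular; the weights are (semi)definite
    (hC : IsUnit D.C.det)
    (hQ : ∀ t, (D.Q t).PosSemidef) (hR : ∀ t, (D.R t).PosDef)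
    (hPterm : ∀ T, (D.Pterm T).PosSemidef)
    -- the unknown noise probabilities, the noises and the initial state
    (p : Fin M → ℝ) (hp : p ∈ stdSimplex ℝ (Fin M))
    (x₀ : Ω → Fin n → ℝ) (w v : ℕ → Ω → Fin n → ℝ) (v_b : ℝ)
    (hx₀_meas : Measurable x₀) (hx₀ : HasGaussianLaw x₀ P)
    (hw_meas : ∀ t, Measurable (w t))
    (hw : ∀ t, P.map (w t) = ∑ i, ENNReal.ofReal (p i) • Measure.dirac (D.atom i))
    (hv_meas : ∀ t, Measurable (v t)) (hv_ident : ∀ t, IdentDistrib (v t) (v 0) P P)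
    (hv_bdd : ∀ t, ∀ᵐ ω ∂P, OutputFeedback.vecNorm (v t ω) ≤ v_b)
    (hv_mean : ∫ ω, v 0 ω ∂P = 0)
    (hindep : iIndepFun (Sum.elim (fun _ : Unit => x₀) (Sum.elim w v)) P)
    -- separation of the values of the system noise
    (hsep : ∀ i j, i ≠ j →
      2 * (1 + OutputFeedback.opNorm D.A) * OutputFeedback.opNorm D.C⁻¹ * v_b
        < OutputFeedback.vecNorm (D.atom i - D.atom j)) :
    -- the system noise is identified exactly: almost surely, for every `t`, the minimizers of
    -- the distance to `ŵ(t)` are exactly the indices of the true value `w(t)`, and hence the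
    -- estimate computed by the policy is the empirical frequency of the true noise values
    (∀ T, ∀ᵐ ω ∂P, ∀ t,
      (∀ i, (∀ j,
          OutputFeedback.vecNorm
              (OutputFeedback.noiseEst D (OutputFeedback.learningPolicy D T) x₀ w v t ω - D.atom i)
            ≤ OutputFeedback.vecNorm
              (OutputFeedback.noiseEst D (OutputFeedback.learningPolicy D T) x₀ w v t ω
                - D.atom j))
        ↔ w t ω = D.atom i) ∧
      (∀ i, OutputFeedback.historyProbEst D t
          (fun s => OutputFeedback.output D (OutputFeedback.learningPolicy D T) x₀ w v s ω)
          (fun s => OutputFeedback.input D (OutputFeedback.learningPolicy D T) x₀ w v s ω) i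
        = ({s : Fin t | w s ω = D.atom i}.ncard : ℝ) / t)) ∧
    -- the cost of the learning policy
    (∀ T,
      (∀ t ≤ T, (OutputFeedback.dMat D T t).PosSemidef) ∧
      OutputFeedback.CostIntegrable P D (OutputFeedback.learningPolicy D T) x₀ w v T ∧
      Integrable (fun ω =>
        (D.C⁻¹ *ᵥ (D.C *ᵥ x₀ ω + v 0 ω)) ⬝ᵥ
            (OutputFeedback.riccati D T 0 *ᵥ (D.C⁻¹ *ᵥ (D.C *ᵥ x₀ ω + v 0 ω)))
          + 2 * ((D.C⁻¹ *ᵥ (D.C *ᵥ x₀ ω + v 0 ω)) ⬝ᵥ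
            (OutputFeedback.adjointL D T 0 *ᵥ OutputFeedback.meanOf D.atom p))) P ∧
      OutputFeedback.cost P D (OutputFeedback.learningPolicy D T) x₀ w v T
        = ∫ ω, ((D.C⁻¹ *ᵥ (D.C *ᵥ x₀ ω + v 0 ω)) ⬝ᵥ
              (OutputFeedback.riccati D T 0 *ᵥ (D.C⁻¹ *ᵥ (D.C *ᵥ x₀ ω + v 0 ω)))
            + 2 * ((D.C⁻¹ *ᵥ (D.C *ᵥ x₀ ω + v 0 ω)) ⬝ᵥ
              (OutputFeedback.adjointL D T 0 *ᵥ OutputFeedback.meanOf D.atom p))) ∂P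
          + OutputFeedback.hConst D p
              (D.C⁻¹ * OutputFeedback.momentMatrix P (v 0) * (D.C⁻¹)ᵀ) T
          + (OutputFeedback.dMat D T 0 * vecMulVec (OutputFeedback.meanOf D.atom p)
              (OutputFeedback.meanOf D.atom p)).trace
          + ∑ t ∈ Finset.Icc 1 T, (1 / (t : ℝ)) *
              (OutputFeedback.dMat D T t * OutputFeedback.covariance D.atom p).trace) ∧
    -- the quasi-regret with respect to the offline policy
    (∀ T,
      OutputFeedback.CostIntegrable P D (OutputFeedback.offlinePolicy D p T) x₀ w v T ∧
      OutputFeedback.quasiRegret P D p x₀ w v T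
        = (OutputFeedback.dMat D T 0 * vecMulVec (OutputFeedback.meanOf D.atom p)
              (OutputFeedback.meanOf D.atom p)).trace
          + ∑ t ∈ Finset.Icc 1 T, (1 / (t : ℝ)) *
              (OutputFeedback.dMat D T t * OutputFeedback.covariance D.atom p).trace) ∧
    -- logarithmic growth for constant weights, zero terminal weight, `(A, B)` stabilizable and
    -- `(A, Q^{1/2})` observable
    ((∀ t, D.Q t = D.Q 0) → (∀ t, D.R t = D.R 0) → (∀ T, D.Pterm T = 0) →
      OutputFeedback.Stabilizable D.A D.B →
      (∃ S : Matrix (Fin n) (Fin n) ℝ, S.PosSemidef ∧ S * S = D.Q 0 ∧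
        OutputFeedback.Observable D.A S) →
      (fun T : ℕ => OutputFeedback.quasiRegret P D p x₀ w v T)
        =O[atTop] (fun T : ℕ => Real.log T)) := by
  -- The Gaussian law enters only through its finite second moment.
  have h : OutputFeedback.NoiseModel P D p x₀ w v v_b :=
    ⟨hp, hx₀_meas, hx₀.memLp_two, hw_meas, hw, hv_meas, hv_ident, hv_bdd, hv_mean, hindep⟩
  have hgood : ∀ᵐ ω ∂P, (∀ t, OutputFeedback.vecNorm (v t ω) ≤ v_b) ∧
      ∀ t, ∃ i, w t ω = D.atom i :=
    (ae_all_iff.2 hv_bdd).and (ae_all_iff.2 h.ae_mem_atoms)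
  have hlearn := fun T => OutputFeedback.cost_of_certaintyEquivalent (T := T)
    (π := OutputFeedback.learningPolicy D T) hC hQ hR hPterm h
    OutputFeedback.measurable_sampleMean (OutputFeedback.memLp_sampleMean h) (by
      filter_upwards [hgood] with ω hω t
      exact OutputFeedback.input_learningPolicy hC hsep hω.1 hω.2 T t)
  have hoff := fun T => OutputFeedback.cost_of_certaintyEquivalent (T := T)
    (π := OutputFeedback.offlinePolicy D p T)
    (ν := fun _ _ => OutputFeedback.meanOf D.atom p) hC hQ hR hPterm h
    (fun _ => measurable_const) (fun _ => memLp_const _)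
    (ae_of_all _ fun ω t => OutputFeedback.input_offlinePolicy p T t ω)
  have hregret : ∀ T, OutputFeedback.quasiRegret P D p x₀ w v T
      = (OutputFeedback.dMat D T 0 * vecMulVec (OutputFeedback.meanOf D.atom p)
            (OutputFeedback.meanOf D.atom p)).trace
        + ∑ t ∈ Finset.Icc 1 T, (1 / (t : ℝ)) *
            (OutputFeedback.dMat D T t * OutputFeedback.covariance D.atom p).trace := fun T => by
    rw [OutputFeedback.quasiRegret, (hlearn T).2.2, (hoff T).2.2,
      OutputFeedback.sum_sampleMean_error h]
    -- The initial value and `H_T` are common to both costs, and the offline error `μ_w - ν` is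
    -- zero.
    simp
  refine ⟨fun T => ?_, fun T => ⟨fun t _ => OutputFeedback.dMat_posSemidef hQ hR hPterm T t,
    (hlearn T).1, (hlearn T).2.1, ?_⟩, fun T => ⟨(hoff T).1, hregret T⟩, ?_⟩
  · filter_upwards [hgood] with ω hω t
    exact ⟨OutputFeedback.minimizer_iff hC hsep hω.1 (hω.2 t),
      OutputFeedback.historyProbEst_eq_frequency hC hsep hω.1 hω.2 t⟩
  · rw [(hlearn T).2.2, OutputFeedback.sum_sampleMean_error h, ← add_assoc]
  · intro hQc hRc hPc hst hobs
    obtain ⟨c₀, hc₀⟩ := OutputFeedback.dMat_trace_bounded (hR 0) hQc hRc hPc hst hobs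
      (vecMulVec (OutputFeedback.meanOf D.atom p) (OutputFeedback.meanOf D.atom p))
    obtain ⟨c, hc⟩ := OutputFeedback.dMat_trace_bounded (hR 0) hQc hRc hPc hst hobs
      (OutputFeedback.covariance D.atom p)
    exact OutputFeedback.isBigO_log_of_harmonic_bound hregret (fun T => hc₀ T 0 (Nat.zero_le T)) hc
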